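/- For $n\in\mathbb N$ let $\mathcal D_n^1$ be the manifold of strictly positive definite complex $n\times n$ matrices of trace $1$; its tangent space at each point is the real space of traceless Hermitian matrices. For a vector $x\in\mathbb R^n$ let $x^\downarrow$ be its decreasing rearrangement, and for Hermitian $A,B$ with eigenvalue vectors $\lambda(A),\lambda(B)$ (with multiplicities) write $A\succ B$ ("$A$ is more mixed than $B$") if $\sum_{i\le k}\lambda(A)^\downarrow_i\le\sum_{i\le k}\lambda(B)^\downarrow_i$ for $k=1,\dots,n-1$, with equality for $k=n$. A function $F:\mathcal D_n^1\to\mathbb R$ is Schur-increasing if $A\succ B$ implies $F(A)\ge F(B)$. For $p\in(1,\infty)$ let $\tilde p=p/(p-1)$ and, for $x>0$, $$f_p(x)=\frac1{p\tilde p}\,\frac{(x-1)^2}{(x^{1/p}-1)(x^{1/\tilde p}-1)}\quad(x\ne1),\qquad f_p(1)=1 .$$ The WYD($p$) metric on $\mathcal D_n^1$ is the Riemannian metric $$\langle A,B\rangle_{\rho,f_p}=\mathrm{Tr}\bigl(A\,c(L_\rho,R_\rho)(B)\bigr),\qquad c(x,y)=\frac1{y f_p(x/y)},$$ where $L_\rho(A)=\rho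 A$ and $R_\rho(A)=A\rho$. Let $\mathrm{Scal}_{f_p}(\rho)$ be its scalar curvature at $\rho\in\mathcal D_n^1$. Consider the following conjecture (C): there is $\varepsilon>0$ such that for every $p\in(1,1+\varepsilon)$ the function $\mathrm{Scal}_{f_p}$ is Schur-increasing on $\mathcal D_n^1$, for every $n$. **Theorem.** If (C) holds, then there is $\varepsilon>0$ such that for every $p\in(1,1+\varepsilon)$ the following holds. For $\rho\in\mathcal D_2^1$ with eigenvalues $\lambda_1,\lambda_2$ (in either order), $\mathrm{Scal}_{f_p}(\rho)$ depends only on $a=2\lambda_1-1\in(-1,1)$; and the function $r_p:(-1,1)\to\mathbb R$, $r_p(a)=\mathrm{Scal}_{f_p}(\rho)$, so defined is concave on $(-1,1)$ and attains its maximum at $a=0$. -/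

import Mathlib

noncomputable section

/-! ### Majorization -/

/-- The decreasing rearrangement `x↓` of a real vector. -/
def decreasingRearrangement {n : ℕ} (x : Fin n → ℝ) : Fin n → ℝ :=
  x ∘ Tuple.sort (fun i => -x i)

/-- `x ≻ y`: the vector `x` is more mixed than `y`. (For `k ≥ n` the inequality is implied by the
equality of the total sums.) -/
def VecMoreMixed {n : ℕ} (x y : Fin n → ℝ) : Prop :=
  (∀ k : ℕ, ∑ i with i.val < k, decreasingRearrangement x i
      ≤ ∑ i with i.val < k, decreasingRearrangement y i) ∧
    ∑ i, decreasingRearrangement x i = ∑ i, decreasingRearrangement y i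

/-- The real vector of eigenvalues, with multiplicity, of a Hermitian matrix
(by convention `0` if the matrix is not Hermitian). -/
def hermEigenvalues {n : ℕ} (A : Matrix (Fin n) (Fin n) ℂ) : Fin n → ℝ :=
  open Classical in if h : A.IsHermitian then h.eigenvalues else 0

/-- `A ≻ B` for Hermitian matrices: the eigenvalue vector of `A` is more mixed than that of `B`. -/
def MatMoreMixed {n : ℕ} (A B : Matrix (Fin n) (Fin n) ℂ) : Prop :=
  VecMoreMixed (hermEigenvalues A) (hermEigenvalues B)

/-- A real function on a set `S` of Hermitian matrices is Schur-increasing. -/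
def SchurIncreasingOn {n : ℕ} (S : Set (Matrix (Fin n) (Fin n) ℂ))
    (F : Matrix (Fin n) (Fin n) ℂ → ℝ) : Prop :=
  ∀ A ∈ S, ∀ B ∈ S, MatMoreMixed A B → F B ≤ F A

/-! ### The manifold of faithful density matrices, with a global affine chart -/

open scoped ComplexOrder in
/-- The strictly positive `n × n` density matrices. -/
def densityMatrices (n : ℕ) : Set (Matrix (Fin n) (Fin n) ℂ) :=
  {ρ | ρ.PosDef ∧ ρ.trace = 1}

/-- Pairs `(i, j)` other than `(n, n)`: an index set with `n² - 1` elements (for `n ≥ 1`). -/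
abbrev FrameIndex (n : ℕ) : Type :=
  {q : Fin n × Fin n // ¬ (q.1.val + 1 = n ∧ q.2.val + 1 = n)}

/-- A basis of the real vector space of traceless Hermitian matrices, the tangent space of
`densityMatrices n` at each of its points: `E_ij + E_ji` for `i < j`, `𝐢 (E_ij - E_ji)` for
`j < i`, and `E_ii - E_nn` for `i < n`. (For `n = 2` these are the Pauli matrices.) -/
def tracelessFrame (n : ℕ) (q : FrameIndex n) : Matrix (Fin n) (Fin n) ℂ :=
  let i := q.1.1
  let j := q.1.2
  if i < j then Matrix.single i j 1 + Matrix.single j i 1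
  else if j < i then Matrix.single i j Complex.I - Matrix.single j i Complex.I
  else Matrix.single i i 1 -
    Matrix.single ⟨n - 1, by have := i.2; omega⟩ ⟨n - 1, by have := i.2; omega⟩ 1

theorem tracelessFrame_isHermitian (n : ℕ) (q : FrameIndex n) :
    (tracelessFrame n q).IsHermitian := by
  unfold tracelessFrame Matrix.IsHermitian
  dsimp only
  split_ifs
  · simp [Matrix.conjTranspose_single, add_comm]
  · have h : ∀ i j : Fin n, Matrix.single i j (-Complex.I) = -Matrix.single i j Complex.I :=
      fun i j => by ext a b; simp [Matrix.single_apply]; split_ifs <;> simp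
    simp only [Matrix.conjTranspose_sub, Matrix.conjTranspose_single, Complex.star_def,
      Complex.conj_I, h]
    abel
  · simp [Matrix.conjTranspose_single]

theorem tracelessFrame_trace (n : ℕ) (q : FrameIndex n) : (tracelessFrame n q).trace = 0 := by
  unfold tracelessFrame
  dsimp only
  split_ifs with h h'
  · simp [Matrix.trace_single_eq_of_ne, h.ne, h.ne']
  · simp [Matrix.trace_single_eq_of_ne, h'.ne, h'.ne']
  · simp [Matrix.trace_single_eq_same]

theorem tracelessFrame_linearIndependent (n : ℕ) : LinearIndependent ℝ (tracelessFrame n) := by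
  rw [Fintype.linearIndependent_iff]
  intro c hc
  have key : ∀ q q' : FrameIndex n,
      (if q.1.2 < q.1.1 then ((tracelessFrame n q') q.1.1 q.1.2).im
        else if q.1.1 < q.1.2 then ((tracelessFrame n q') q.1.1 q.1.2).re
        else ((tracelessFrame n q') q.1.1 q.1.1).re) = if q' = q then 1 else 0 := by
    rintro ⟨⟨i, j⟩, h⟩ ⟨⟨i', j'⟩, h'⟩
    have e1 := i.2
    have e2 := i'.2
    unfold tracelessFrame
    simp only [Fin.lt_def, Subtype.mk.injEq, Prod.mk.injEq, Fin.ext_iff] at h h' ⊢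
    split_ifs <;> (try simp [Matrix.single_apply, Fin.ext_iff]) <;> (try split_ifs) <;>
      (try simp) <;> (try omega)
  intro q
  have hq := congrFun (congrFun hc q.1.1) q.1.2
  have hq' := congrFun (congrFun hc q.1.1) q.1.1
  have : ∑ q', c q' * (if q' = q then (1:ℝ) else 0) = 0 := by
    simp only [← key q]
    rw [Matrix.sum_apply] at hq hq'
    have a1 := congrArg Complex.im hq
    have a2 := congrArg Complex.re hq
    have a3 := congrArg Complex.re hq'
    simp at a1 a2 a3
    split_ifs <;> assumption
  simpa using this

/-! ### Scalar curvature in affine coordinates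

`M` is a real vector space, and `e` a finite family of linearly independent vectors of `M`. On a
relatively open subset of an affine subspace of `M` directed by the span of `e`, the numbers `x_i`
in `ρ + ∑ i, x_i • e i` are coordinates whose coordinate vector fields are the constant fields
`e i`. The formulas below are the classical ones for a Riemannian metric `g` in such coordinates. -/

section Curvature

variable {M : Type*} [AddCommGroup M] [Module ℝ M] {ι : Type*} [Fintype ι] [DecidableEq ι]

/-- The matrix `g_ij` of the metric. -/
def metricMatrix (g : M → M → M → ℝ) (e : ι → M) (x : M) : Matrix ι ι ℝ :=
  Matrix.of fun i j => g x (e i) (e j)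

/-- `Γ^k_ij = ½ ∑_l g^{kl} (∂_i g_jl + ∂_j g_il - ∂_l g_ij)`. -/
def christoffel (g : M → M → M → ℝ) (e : ι → M) (k i j : ι) (x : M) : ℝ :=
  (1 / 2) * ∑ l, (metricMatrix g e x)⁻¹ k l *
    (lineDeriv ℝ (fun y => metricMatrix g e y j l) x (e i)
      + lineDeriv ℝ (fun y => metricMatrix g e y i l) x (e j)
      - lineDeriv ℝ (fun y => metricMatrix g e y i j) x (e l))

/-- `R^l_kij = ∂_i Γ^l_jk - ∂_j Γ^l_ik + ∑_m (Γ^l_im Γ^m_jk - Γ^l_jm Γ^m_ik)`. -/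
def riemannTensor (g : M → M → M → ℝ) (e : ι → M) (l k i j : ι) (x : M) : ℝ :=
  lineDeriv ℝ (christoffel g e l j k) x (e i) - lineDeriv ℝ (christoffel g e l i k) x (e j)
    + ∑ m, (christoffel g e l i m x * christoffel g e m j k x
      - christoffel g e l j m x * christoffel g e m i k x)

/-- `Ric_kj = ∑_i R^i_kij`. -/
def ricciTensor (g : M → M → M → ℝ) (e : ι → M) (k j : ι) (x : M) : ℝ :=
  ∑ i, riemannTensor g e i k i j x

/-- `Scal = ∑_{k,j} g^{kj} Ric_kj` (positive for round spheres). -/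
def scalarCurvature (g : M → M → M → ℝ) (e : ι → M) (x : M) : ℝ :=
  ∑ k, ∑ j, (metricMatrix g e x)⁻¹ k j * ricciTensor g e k j x

end Curvature

/-! ### Monotone metrics -/

/-- The Chentsov–Morozova function `c_f(x, y) = 1 / (y f(x / y))`. -/
def chentsovMorozova (f : ℝ → ℝ) (x y : ℝ) : ℝ :=
  1 / (y * f (x / y))

open Classical in
/-- `c(L_ρ, R_ρ)(B)`, where `L_ρ` and `R_ρ` are left and right multiplication by the Hermitian
matrix `ρ`: if `ρ = U diag(λ) U*`, then `c(L_ρ, R_ρ)` multiplies the `(i, j)` entry of `U* B U`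
by `c(λ_i, λ_j)`. -/
def leftRightCalculus {n : ℕ} (c : ℝ → ℝ → ℝ) (ρ B : Matrix (Fin n) (Fin n) ℂ) :
    Matrix (Fin n) (Fin n) ℂ :=
  if h : ρ.IsHermitian then
    let U : Matrix (Fin n) (Fin n) ℂ := h.eigenvectorUnitary
    U * (Matrix.of fun i j =>
      (c (h.eigenvalues i) (h.eigenvalues j) : ℂ) * (U.conjTranspose * B * U) i j)
      * U.conjTranspose
  else 0

/-- The metric `⟨A, B⟩_{ρ,f} = Tr(A · c_f(L_ρ, R_ρ)(B))` (a real number for Hermitian `A`, `B`). -/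
def monotoneMetric {n : ℕ} (f : ℝ → ℝ) (ρ A B : Matrix (Fin n) (Fin n) ℂ) : ℝ :=
  (A * leftRightCalculus (chentsovMorozova f) ρ B).trace.re

/-- The scalar curvature at `ρ` of the manifold of density matrices with the metric
`⟨·, ·⟩_{ρ,f}`. -/
def monotoneScal {n : ℕ} (f : ℝ → ℝ) (ρ : Matrix (Fin n) (Fin n) ℂ) : ℝ :=
  scalarCurvature (monotoneMetric f) (tracelessFrame n) ρ

/-! ### The Wigner–Yanase–Dyson metrics -/

/-- The function `f_p` for `p ≥ 1`, extended by continuity by the value `1` at `x = 1`; here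
`q = p / (p - 1)` is the conjugate exponent. -/
def wydFun (p x : ℝ) : ℝ :=
  if x = 1 then 1
  else if p = 1 then (x - 1) / Real.log x
  else
    let q := p / (p - 1)
    1 / (p * q) * ((x - 1) ^ 2 / ((x ^ (1 / p) - 1) * (x ^ (1 / q) - 1)))

/-- The conjecture on the WYD metrics: for some `ε > 0` and all `p ∈ (1, 1 + ε)`, the scalar
curvature of the WYD(p) metric (on the density matrices of every size `n`) is Schur-increasing. -/
def WYDConjecture : Prop :=
  ∃ ε : ℝ, 0 < ε ∧ ∀ p ∈ Set.Ioo 1 (1 + ε), ∀ n : ℕ,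
    SchurIncreasingOn (densityMatrices n) (monotoneScal (wydFun p))

/-- `r_p(a)`: the scalar curvature of the WYD(p) metric at the `2 × 2` density matrix
`diag((1 + a) / 2, (1 - a) / 2)`. -/
def wydScalTwo (p a : ℝ) : ℝ :=
  monotoneScal (wydFun p) (Matrix.diagonal ![(((1 + a) / 2 : ℝ) : ℂ), (((1 - a) / 2 : ℝ) : ℂ)])

end

/-!
The curvature of the `2 × 2` density matrices can be computed in closed form, and the closed form
is `3 / 2` minus a power series in `a ^ 2` with nonnegative coefficients. Such a function is
concave and has its maximum at `0`. This holds for all `p` with `1 < p < 2`.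

In the coordinates `ρ = 1 / 2 + ∑ x_i σ_i` given by the Pauli matrices, every monotone metric is
radial: `g_ij = A δ_ij + B x_i x_j`, where `A` and `B` depend on `|x| ^ 2` only
(`monotoneMetric_blochMatrix`). The scalar curvature of a radial metric in dimension three is an
explicit expression in `A`, `B` and their derivatives (`IsRadialMetric.scalarCurvature_eq`), so it
is a function of `s = 4 |x| ^ 2`, and `s = (2 λ - 1) ^ 2` for each eigenvalue `λ` of `ρ`.

For the WYD metric put `α = 1 / p`, `β = 1 - 1 / p`, `s = r ^ 2`, `r = tanh v`, and
`1 - s φ_b(s) = b r coth (b v)`. The metric is a rational function of `s`, `φ_α` and `φ_β`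
(`chentsovMorozova_wydFun`). The Riccati equation of `coth` (`cothSeries_riccati`) and its
addition theorem (`coth_addition`) eliminate all derivatives from the curvature, and what remains
is (`radialScal_wyd_of_pos`, `monotoneScal_blochMatrix`)

  `Scal = 3 / 2 - (3 / 2 m ^ 2 - s (m g + g ^ 2 / 2)) / (1 - s)`,  `g = φ_β - φ_α`,  `m = α - β`.

The Riccati equation is also a recursion for the Taylor coefficients of `φ_b`, all of whose terms
are positive. By induction the coefficients are nonnegative and decrease in `b ∈ [0, 1]`
(`cothCoeff_nonneg`, `cothCoeff_antitone`), and they sum to `1 - b` (`hasSum_cothCoeff`). Since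
`β < α`, the coefficients of `g` are nonnegative and sum to `m`. The fraction above is a combination
of divided differences of `g` between `s` and `1`, so its Taylor coefficients are nonnegative, too
(`hasNonnegExpansion_wydProfile`).
-/

noncomputable section

open Topology

/-! ### The Taylor coefficients of `b r coth (b artanh r)` -/

/-- The coefficients `c_n` of `1 - b r coth (b artanh r) = s ∑ c_n s ^ n`, where `s = r ^ 2`. They
are defined by the recursion that the Riccati equation of `coth` forces on them, because the
recursion shows their signs and their monotonicity in `b`. -/
def cothCoeff (b : ℝ) : ℕ → ℝ
  | 0 => (1 - b ^ 2) / 3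
  | n + 1 => ((2 * n + 1) * cothCoeff b n
      + ∑ i : Fin (n + 1), cothCoeff b i * cothCoeff b (n - i)) / (2 * n + 5)

theorem cothCoeff_zero (b : ℝ) : cothCoeff b 0 = (1 - b ^ 2) / 3 := by
  rw [cothCoeff]

theorem cothCoeff_succ (b : ℝ) (n : ℕ) :
    (2 * n + 5) * cothCoeff b (n + 1) = (2 * n + 1) * cothCoeff b n
      + ∑ q ∈ Finset.HasAntidiagonal.antidiagonal n, cothCoeff b q.1 * cothCoeff b q.2 := by
  rw [cothCoeff, mul_div_cancel₀ (b := 2 * (n : ℝ) + 5) _ (by positivity),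
    Finset.Nat.sum_antidiagonal_eq_sum_range_succ_mk, Finset.sum_range]

theorem cothCoeff_nonneg {b : ℝ} (h0 : 0 ≤ b) (h1 : b ≤ 1) (n : ℕ) : 0 ≤ cothCoeff b n := by
  induction n using Nat.strong_induction_on with
  | _ n ih =>
    cases n with
    | zero => rw [cothCoeff_zero]; nlinarith
    | succ n =>
      rw [cothCoeff]
      have := ih n n.lt_succ_self
      have : 0 ≤ ∑ i : Fin (n + 1), cothCoeff b i * cothCoeff b (n - i) :=
        Finset.sum_nonneg fun i _ => mul_nonneg (ih _ i.2) (ih _ (by omega))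
      positivity

theorem cothCoeff_antitone {a b : ℝ} (h0 : 0 ≤ a) (hab : a ≤ b) (h1 : b ≤ 1) (n : ℕ) :
    cothCoeff b n ≤ cothCoeff a n := by
  induction n using Nat.strong_induction_on with
  | _ n ih =>
    cases n with
    | zero => rw [cothCoeff_zero, cothCoeff_zero]; gcongr
    | succ n =>
      rw [cothCoeff, cothCoeff]
      have h := ih n n.lt_succ_self
      gcongr with i
      · exact cothCoeff_nonneg (h0.trans hab) h1 _
      · exact cothCoeff_nonneg h0 (hab.trans h1) _
      · exact ih _ i.2
      · exact ih _ (by omega)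

/-- The recursion, summed over `n < N`. The coefficients on its two sides telescope, and only the
last term and twice the partial sum remain. -/
theorem cothCoeff_telescope (b : ℝ) (N : ℕ) :
    (2 * N + 3) * cothCoeff b N + 2 * ∑ k ∈ Finset.range N, cothCoeff b k = 1 - b ^ 2
      + ∑ k ∈ Finset.range N, ∑ q ∈ Finset.HasAntidiagonal.antidiagonal k,
          cothCoeff b q.1 * cothCoeff b q.2 := by
  induction N with
  | zero => simp [cothCoeff_zero]; ring
  | succ n ih =>
    have := cothCoeff_succ b n
    rw [Finset.sum_range_succ, Finset.sum_range_succ]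
    push_cast
    linarith

/-- If `E` is the sum of the first `N` coefficients, the convolution terms sum to at most `E ^ 2`,
so the telescoped recursion gives `3 c_N ≤ (1 - E) ^ 2`, and `E + c_N ≤ 1` follows from `E ≤ 1`. -/
theorem sum_cothCoeff_le_one {b : ℝ} (h0 : 0 ≤ b) (h1 : b ≤ 1) (N : ℕ) :
    ∑ k ∈ Finset.range N, cothCoeff b k ≤ 1 := by
  induction N with
  | zero => simp
  | succ n ih =>
    have hc := cothCoeff_nonneg h0 h1
    have hs : 0 ≤ ∑ k ∈ Finset.range n, cothCoeff b k := Finset.sum_nonneg fun k _ => hc k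
    have hconv : ∑ k ∈ Finset.range n, ∑ q ∈ Finset.HasAntidiagonal.antidiagonal k,
        cothCoeff b q.1 * cothCoeff b q.2 ≤ (∑ k ∈ Finset.range n, cothCoeff b k) ^ 2 := by
      simp only [Finset.Nat.sum_antidiagonal_eq_sum_range_succ_mk]
      rw [Finset.sum_range_diag_flip n fun i j => cothCoeff b i * cothCoeff b j, sq,
        Finset.sum_mul_sum]
      refine Finset.sum_le_sum fun i _ => Finset.sum_le_sum_of_subset_of_nonneg ?_
        fun j _ _ => mul_nonneg (hc i) (hc j)
      exact Finset.range_mono (Nat.sub_le n i)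
    have ht := cothCoeff_telescope b n
    have h2 : (2 * n + 3) * cothCoeff b n ≤ (1 - ∑ k ∈ Finset.range n, cothCoeff b k) ^ 2 := by
      nlinarith
    have h3 : 3 * cothCoeff b n ≤ (2 * n + 3) * cothCoeff b n := by
      have : 0 ≤ (n : ℝ) * cothCoeff b n := mul_nonneg n.cast_nonneg (hc n)
      linarith
    rw [Finset.sum_range_succ]
    nlinarith

theorem summable_cothCoeff {b : ℝ} (h0 : 0 ≤ b) (h1 : b ≤ 1) : Summable (cothCoeff b) :=
  summable_of_sum_range_le (cothCoeff_nonneg h0 h1) (sum_cothCoeff_le_one h0 h1)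

/-- The function `φ_b` with `1 - s φ_b(s) = b r coth (b artanh r)` for `s = r ^ 2`, as a power
series; this makes it analytic at `s = 0`, and it also extends it to negative `s`. -/
def cothSeries (b s : ℝ) : ℝ := ∑' n, cothCoeff b n * s ^ n

theorem analyticOnNhd_tsum_mul_pow {c : ℕ → ℝ} (hc : Summable fun n => ‖c n‖) :
    AnalyticOnNhd ℝ (fun s : ℝ => ∑' n, c n * s ^ n) (Metric.ball 0 1) := by
  have hr : (1 : ENNReal) ≤ (FormalMultilinearSeries.ofScalars ℝ c).radius := by
    refine FormalMultilinearSeries.le_radius_of_summable (r := 1) _ ?_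
    simpa [FormalMultilinearSeries.ofScalars_norm] using hc
  have h := ((FormalMultilinearSeries.ofScalars ℝ c).hasFPowerSeriesOnBall
    (lt_of_lt_of_le one_pos hr)).analyticOnNhd
  have he : (FormalMultilinearSeries.ofScalars ℝ c).sum = fun s : ℝ => ∑' n, c n * s ^ n := by
    ext s
    simp [FormalMultilinearSeries.sum, mul_comm]
  rw [he] at h
  refine h.mono ?_
  rw [← Metric.eball_ofReal]
  exact Metric.eball_subset_eball (by simpa using hr)

/-- The Euler operator `s * d/ds` acts on a power series by multiplying the coefficients by `n`. -/
theorem hasSum_mul_deriv_tsum {c : ℕ → ℝ} (hc : Summable fun n => ‖c n‖) {s : ℝ} (hs : |s| < 1) :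
    HasSum (fun n => n * (c n * s ^ n)) (s * deriv (fun s : ℝ => ∑' n, c n * s ^ n) s) := by
  obtain ⟨t, hst, ht1⟩ := exists_between hs
  have ht0 : 0 < t := (abs_nonneg s).trans_lt hst
  have hcb : ∀ n, ‖c n‖ ≤ ∑' n, ‖c n‖ := fun n => hc.le_tsum n fun _ _ => norm_nonneg _
  have hsum : Summable fun n : ℕ => (∑' n, ‖c n‖) / t * (n * t ^ n) := by
    refine Summable.mul_left _ ?_
    simpa using summable_pow_mul_geometric_of_norm_lt_one (R := ℝ) 1
      (by rwa [Real.norm_of_nonneg ht0.le])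
  have hb : ∀ (n : ℕ), ∀ y ∈ Metric.ball (0 : ℝ) t,
      ‖c n * (n * y ^ (n - 1))‖ ≤ (∑' n, ‖c n‖) / t * (n * t ^ n) := by
    intro n y hy
    have hy' : |y| ≤ t := by simpa using (Metric.mem_ball.1 hy).le
    rcases n with _ | n
    · simp
    · have : ‖c (n + 1) * (((n + 1 : ℕ) : ℝ) * y ^ (n + 1 - 1))‖
          ≤ (∑' n, ‖c n‖) * (((n + 1 : ℕ) : ℝ) * t ^ n) := by
        rw [norm_mul, norm_mul, norm_pow, Real.norm_natCast, Nat.add_sub_cancel, Real.norm_eq_abs y]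
        gcongr
        exact hcb _
      refine this.trans_eq ?_
      field_simp
      ring
  have hs' : s ∈ Metric.ball (0 : ℝ) t := by simpa using hst
  have hd := hasDerivAt_tsum_of_isPreconnected (g := fun n y => c n * y ^ n) hsum
    Metric.isOpen_ball (convex_ball (0 : ℝ) t).isPreconnected
    (fun n y _ => (hasDerivAt_pow n y).const_mul (c n)) hb (Metric.mem_ball_self ht0)
    (summable_of_ne_finset_zero (s := {0}) fun n hn => by
      simp only [Finset.mem_singleton] at hn; simp [hn]) hs'
  rw [hd.deriv]
  have := (Summable.of_norm_bounded hsum fun n => hb n s hs').hasSum.mul_left s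
  refine this.congr_fun ?_
  intro n
  rcases n with _ | n
  · simp
  · rw [Nat.add_sub_cancel]; ring

theorem summable_norm_cothCoeff {b : ℝ} (h0 : 0 ≤ b) (h1 : b ≤ 1) :
    Summable fun n => ‖cothCoeff b n‖ := (summable_cothCoeff h0 h1).norm

theorem summable_cothCoeff_mul_pow {b : ℝ} (h0 : 0 ≤ b) (h1 : b ≤ 1) {s : ℝ} (hs : |s| ≤ 1) :
    Summable fun n => ‖cothCoeff b n * s ^ n‖ := by
  refine (summable_norm_cothCoeff h0 h1).of_nonneg_of_le (fun _ => norm_nonneg _) fun n => ?_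
  rw [norm_mul, norm_pow]
  exact mul_le_of_le_one_right (norm_nonneg _) (pow_le_one₀ (norm_nonneg _) hs)

theorem analyticOnNhd_cothSeries {b : ℝ} (h0 : 0 ≤ b) (h1 : b ≤ 1) :
    AnalyticOnNhd ℝ (cothSeries b) (Metric.ball 0 1) :=
  analyticOnNhd_tsum_mul_pow (summable_norm_cothCoeff h0 h1)

/-- The recursion for the coefficients, as a Riccati equation for the generating function. -/
theorem cothSeries_riccati {b : ℝ} (h0 : 0 ≤ b) (h1 : b ≤ 1) {s : ℝ} (hs : |s| < 1) :
    2 * s * (1 - s) * deriv (cothSeries b) s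
      = 1 - b ^ 2 - 3 * cothSeries b s + s * cothSeries b s + s * cothSeries b s ^ 2 := by
  have hn := summable_cothCoeff_mul_pow h0 h1 hs.le
  have hsq : HasSum (fun n => ∑ q ∈ Finset.HasAntidiagonal.antidiagonal n,
      cothCoeff b q.1 * s ^ q.1 * (cothCoeff b q.2 * s ^ q.2)) (cothSeries b s ^ 2) := by
    rw [sq]
    unfold cothSeries
    rw [tsum_mul_tsum_eq_tsum_sum_antidiagonal_of_summable_norm hn hn]
    exact (summable_norm_sum_mul_antidiagonal_of_summable_norm hn hn).of_norm.hasSum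
  have h1' : HasSum (fun n => cothCoeff b n * s ^ n) (cothSeries b s) := hn.of_norm.hasSum
  have h2 := hasSum_mul_deriv_tsum (summable_norm_cothCoeff h0 h1) hs
  change HasSum _ (s * deriv (cothSeries b) s) at h2
  have hL := (h2.mul_left 2).add (h1'.mul_left 3)
  have hR := (((h2.mul_left 2).add h1').add hsq).mul_left s
  rw [← hasSum_nat_add_iff' 1] at hL
  have key := hL.unique (hR.congr_fun fun n => ?_)
  · simp [cothCoeff_zero] at key
    linear_combination key
  · have := cothCoeff_succ b n
    have e : ∑ q ∈ Finset.HasAntidiagonal.antidiagonal n,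
        cothCoeff b q.1 * s ^ q.1 * (cothCoeff b q.2 * s ^ q.2)
        = s ^ n * ∑ q ∈ Finset.HasAntidiagonal.antidiagonal n,
            cothCoeff b q.1 * cothCoeff b q.2 := by
      rw [Finset.mul_sum]
      refine Finset.sum_congr rfl fun q hq => ?_
      rw [← Finset.HasAntidiagonal.mem_antidiagonal.1 hq, pow_add]; ring
    rw [e]
    push_cast
    linear_combination s ^ (n + 1) * this

/-! ### The closed form of the series -/

theorem abs_cothSeries_le_one {b : ℝ} (h0 : 0 ≤ b) (h1 : b ≤ 1) {s : ℝ} (hs : |s| ≤ 1) :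
    |cothSeries b s| ≤ 1 := by
  have hc := summable_cothCoeff h0 h1
  refine (norm_tsum_le_tsum_norm (summable_cothCoeff_mul_pow h0 h1 hs)).trans
    (((summable_cothCoeff_mul_pow h0 h1 hs).tsum_le_tsum (fun n => ?_) hc).trans
      (hc.tsum_le_of_sum_range_le (sum_cothCoeff_le_one h0 h1)))
  rw [norm_mul, norm_pow, Real.norm_of_nonneg (cothCoeff_nonneg h0 h1 n)]
  exact mul_le_of_le_one_right (cothCoeff_nonneg h0 h1 n) (pow_le_one₀ (norm_nonneg _) hs)

theorem continuousOn_cothSeries {b : ℝ} (h0 : 0 ≤ b) (h1 : b ≤ 1) :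
    ContinuousOn (cothSeries b) (Set.Icc 0 1) := by
  refine continuousOn_tsum (fun n => by fun_prop) (summable_cothCoeff h0 h1) fun n s hs => ?_
  rw [norm_mul, norm_pow, Real.norm_of_nonneg (cothCoeff_nonneg h0 h1 n),
    Real.norm_of_nonneg hs.1]
  exact mul_le_of_le_one_right (cothCoeff_nonneg h0 h1 n) (pow_le_one₀ hs.1 hs.2)

theorem hasDerivAt_cothSeries {b : ℝ} (h0 : 0 ≤ b) (h1 : b ≤ 1) {s : ℝ} (hs : |s| < 1) :
    HasDerivAt (cothSeries b) (deriv (cothSeries b) s) s :=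
  (analyticOnNhd_cothSeries h0 h1 s (by simpa using hs)).differentiableAt.hasDerivAt

/-- The identity `1 - r ^ 2 φ_b(r ^ 2) = b r coth (b artanh r)`, cleared of denominators by
`coth (b artanh r) = ((1 + r) ^ b + (1 - r) ^ b) / ((1 + r) ^ b - (1 - r) ^ b)`. The difference `K`
of the two sides solves the linear equation `(1 - r ^ 2) K' = r (φ_b - 1 - b) K`, whose coefficient
is nonpositive, so `K ^ 2` decreases from `K 0 ^ 2 = 0`. -/
theorem cothSeries_rpow {b : ℝ} (h0 : 0 ≤ b) (h1 : b ≤ 1) {r : ℝ} (hr : r ∈ Set.Icc (0 : ℝ) 1) :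
    ((1 + r) ^ b - (1 - r) ^ b) * (1 - r ^ 2 * cothSeries b (r ^ 2))
      = b * r * ((1 + r) ^ b + (1 - r) ^ b) := by
  set K : ℝ → ℝ := fun r => ((1 + r) ^ b - (1 - r) ^ b) * (1 - r ^ 2 * cothSeries b (r ^ 2))
      - b * r * ((1 + r) ^ b + (1 - r) ^ b) with hK
  have hd : ∀ r ∈ Set.Ioo (0 : ℝ) 1,
      HasDerivAt K (K r * (r * (cothSeries b (r ^ 2) - 1 - b)) / (1 - r ^ 2)) r := by
    intro r hr
    have hr2 : |r ^ 2| < 1 := by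
      rw [abs_of_nonneg (sq_nonneg r)]; nlinarith [hr.1, hr.2]
    have p1 : HasDerivAt (fun r : ℝ => (1 + r) ^ b) (1 * b * (1 + r) ^ (b - 1)) r :=
      ((hasDerivAt_id r).const_add 1).rpow_const (Or.inl (by simp; linarith [hr.1]))
    have p2 : HasDerivAt (fun r : ℝ => (1 - r) ^ b) ((-1) * b * (1 - r) ^ (b - 1)) r :=
      ((hasDerivAt_id r).const_sub 1).rpow_const (Or.inl (by simp; linarith [hr.2]))
    have p3 : HasDerivAt (fun r : ℝ => cothSeries b (r ^ 2))
        (deriv (cothSeries b) (r ^ 2) * (2 * r)) r := by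
      exact (HasDerivAt.comp (h₂ := cothSeries b) (h := fun r : ℝ => r ^ 2) r
        (hasDerivAt_cothSeries h0 h1 hr2) (hasDerivAt_pow 2 r)).congr_deriv (by norm_num)
    have q := ((p1.sub p2).mul (((hasDerivAt_pow 2 r).mul p3).const_sub 1)).sub
      (((hasDerivAt_id r).const_mul b).mul (p1.add p2))
    refine q.congr_deriv ?_
    have e1 : (1 + r) ^ (b - 1) = (1 + r) ^ b / (1 + r) := Real.rpow_sub_one (by linarith [hr.1]) b
    have e2 : (1 - r) ^ (b - 1) = (1 - r) ^ b / (1 - r) := Real.rpow_sub_one (by linarith [hr.2]) b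
    have ode := cothSeries_riccati h0 h1 hr2
    have hr0 : r ≠ 0 := hr.1.ne'
    have f1 : (1 + r) ≠ 0 := by linarith [hr.1]
    have f2 : (1 - r) ≠ 0 := by linarith [hr.2]
    have f3 : (1 - r ^ 2) ≠ 0 := by
      have : 1 - r ^ 2 = (1 + r) * (1 - r) := by ring
      rw [this]; exact mul_ne_zero f1 f2
    have ode' : deriv (cothSeries b) (r ^ 2) = (1 - b ^ 2 - 3 * cothSeries b (r ^ 2)
        + r ^ 2 * cothSeries b (r ^ 2) + r ^ 2 * cothSeries b (r ^ 2) ^ 2)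
        / (2 * r ^ 2 * (1 - r ^ 2)) := by
      rw [← ode]; field_simp
    simp only [hK, e1, e2, ode', id, Pi.mul_apply, Pi.sub_apply, Pi.add_apply]
    generalize cothSeries b (r ^ 2) = f
    generalize (1 + r) ^ b = p
    generalize (1 - r) ^ b = q
    have f3' : (1 - r ^ 2) = (1 + r) * (1 - r) := by ring
    rw [f3']
    field_simp
    ring
  have hcont : ContinuousOn K (Set.Icc 0 1) := by
    have c1 : ContinuousOn (fun r : ℝ => cothSeries b (r ^ 2)) (Set.Icc 0 1) :=
      (continuousOn_cothSeries h0 h1).comp (by fun_prop) fun r hr =>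
        ⟨sq_nonneg r, pow_le_one₀ hr.1 hr.2⟩
    have c2 : ContinuousOn (fun r : ℝ => (1 + r) ^ b) (Set.Icc 0 1) :=
      ContinuousOn.rpow_const (by fun_prop) fun _ _ => Or.inr h0
    have c3 : ContinuousOn (fun r : ℝ => (1 - r) ^ b) (Set.Icc 0 1) :=
      ContinuousOn.rpow_const (by fun_prop) fun _ _ => Or.inr h0
    rw [hK]
    fun_prop
  have hanti : AntitoneOn (fun r => K r ^ 2) (Set.Icc 0 1) := by
    have hd2 : ∀ r ∈ Set.Ioo (0 : ℝ) 1, HasDerivAt (fun r => K r ^ 2)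
        (2 * K r * (K r * (r * (cothSeries b (r ^ 2) - 1 - b)) / (1 - r ^ 2))) r := by
      intro r hr
      exact ((hd r hr).fun_pow 2).congr_deriv (by norm_num)
    refine antitoneOn_of_deriv_nonpos (convex_Icc 0 1) (hcont.pow 2) ?_ ?_
    · rw [interior_Icc]
      exact fun r hr => (hd2 r hr).differentiableAt.differentiableWithinAt
    · rw [interior_Icc]
      intro r hr
      rw [(hd2 r hr).deriv]
      have hr2 : r ^ 2 < 1 := by nlinarith [hr.1, hr.2]
      have := le_of_abs_le (abs_cothSeries_le_one h0 h1 (s := r ^ 2)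
        (by rw [abs_of_nonneg (sq_nonneg r)]; exact hr2.le))
      have e : 2 * K r * (K r * (r * (cothSeries b (r ^ 2) - 1 - b)) / (1 - r ^ 2))
          = -(2 * (K r ^ 2 * r * (1 + b - cothSeries b (r ^ 2)) / (1 - r ^ 2))) := by ring
      rw [e, neg_nonpos]
      have a1 : 0 ≤ 1 + b - cothSeries b (r ^ 2) := by linarith
      have a2 : 0 ≤ 1 - r ^ 2 := by linarith
      have := hr.1.le
      positivity
  have h := hanti (Set.left_mem_Icc.2 zero_le_one) hr hr.1
  have hK0 : K 0 = 0 := by simp [hK]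
  simp only [hK0] at h
  have : K r = 0 := by nlinarith [sq_nonneg (K r)]
  exact sub_eq_zero.1 this

/-- The value of `b r coth (b artanh r)` at `r = 1` is `b`. -/
theorem hasSum_cothCoeff {b : ℝ} (h0 : 0 < b) (h1 : b ≤ 1) : HasSum (cothCoeff b) (1 - b) := by
  have h := cothSeries_rpow h0.le h1 (Set.right_mem_Icc.2 zero_le_one)
  have h2 : (0 : ℝ) < 2 ^ b := by positivity
  have e : cothSeries b 1 = 1 - b := by
    norm_num [Real.zero_rpow h0.ne'] at h
    have : (2 : ℝ) ^ b * (1 - cothSeries b 1 - b) = 0 := by linear_combination h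
    rcases mul_eq_zero.1 this with h' | h'
    · exact absurd h' h2.ne'
    · linarith
  rw [← e]
  simpa [cothSeries] using (summable_cothCoeff h0.le h1).hasSum

/-! ### The curvature of radial metrics -/

/-- The Kronecker delta. -/
def kron {ι : Type*} [DecidableEq ι] (i j : ι) : ℝ := if i = j then 1 else 0

/-- The square of the Euclidean norm of a coordinate vector. -/
def sqNorm {ι : Type*} [Fintype ι] (x : ι → ℝ) : ℝ := ∑ i, x i ^ 2

theorem continuous_sqNorm {ι : Type*} [Fintype ι] : Continuous (sqNorm : (ι → ℝ) → ℝ) := by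
  unfold sqNorm; fun_prop

theorem hasDerivAt_coord {ι : Type*} [DecidableEq ι] (x : ι → ℝ) (i j : ι) :
    HasDerivAt (fun t : ℝ => x j + t * kron i j) (kron i j) 0 := by
  simpa using ((hasDerivAt_id (0 : ℝ)).mul_const (kron i j)).const_add (x j)

section RadialMetric

variable {M : Type*} [AddCommGroup M] [Module ℝ M] {ι : Type*} [Fintype ι] [DecidableEq ι]

/-- The point with coordinates `x` in the affine chart with origin `x₀` and frame `e`. -/
def affineChart (x₀ : M) (e : ι → M) (x : ι → ℝ) : M := x₀ + ∑ i, x i • e i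

theorem affineChart_add_smul (x₀ : M) (e : ι → M) (x : ι → ℝ) (i : ι) (t : ℝ) :
    affineChart x₀ e x + t • e i = affineChart x₀ e fun j => x j + t * kron i j := by
  simp [affineChart, kron, add_smul, Finset.sum_add_distrib, add_assoc]

/-- Derivatives along a frame vector are partial derivatives in the coordinates, computed from any
expression that is valid near the point. -/
theorem lineDeriv_affineChart {x₀ : M} {e : ι → M} {F : M → ℝ} {Φ : (ι → ℝ) → ℝ} {x : ι → ℝ}
    (h : ∀ᶠ y in 𝓝 x, F (affineChart x₀ e y) = Φ y) {i : ι} {d : ℝ}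
    (hd : HasDerivAt (fun t : ℝ => Φ fun j => x j + t * kron i j) d 0) :
    lineDeriv ℝ F (affineChart x₀ e x) (e i) = d := by
  have hc : Filter.Tendsto (fun t : ℝ => fun j => x j + t * kron i j) (𝓝 0) (𝓝 x) := by
    have : Continuous fun t : ℝ => fun j => x j + t * kron i j := by fun_prop
    simpa using this.tendsto 0
  rw [lineDeriv, ← hd.deriv]
  refine Filter.EventuallyEq.deriv_eq ?_
  filter_upwards [hc.eventually h] with t ht
  rw [affineChart_add_smul, ht]

theorem hasDerivAt_sqNorm (x : ι → ℝ) (i : ι) :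
    HasDerivAt (fun t : ℝ => sqNorm fun j => x j + t * kron i j) (2 * x i) 0 := by
  have := HasDerivAt.fun_sum (u := Finset.univ) fun j _ => (hasDerivAt_coord x i j).fun_pow 2
  refine this.congr_deriv ?_
  simp [kron]

theorem hasDerivAt_comp_sqNorm {f : ℝ → ℝ} {f' : ℝ} {x : ι → ℝ} (hf : HasDerivAt f f' (sqNorm x))
    (i : ι) :
    HasDerivAt (fun t : ℝ => f (sqNorm fun j => x j + t * kron i j)) (f' * (2 * x i)) 0 := by
  have h0 : (sqNorm fun j => x j + (0 : ℝ) * kron i j) = sqNorm x := by simp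
  exact HasDerivAt.comp (h₂ := f) (0 : ℝ) (h0.symm ▸ hf) (hasDerivAt_sqNorm x i)

/-- In the coordinates of the affine chart, the metric is `g_ij = A(s) δ_ij + B(s) x_i x_j` with
`s = |x| ^ 2`, wherever `s ∈ U`. Here `A'` and `B'` are the derivatives of `A` and `B`. The matrix
`g_ij` has the eigenvalue `A + s B` in the radial direction and `A` across it, and both are required
to be nonzero. -/
structure IsRadialMetric (g : M → M → M → ℝ) (x₀ : M) (e : ι → M) (U : Set ℝ)
    (A A' B B' : ℝ → ℝ) : Prop where
  isOpen : IsOpen U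
  apply : ∀ x : ι → ℝ, sqNorm x ∈ U → ∀ i j,
    g (affineChart x₀ e x) (e i) (e j) = A (sqNorm x) * kron i j + B (sqNorm x) * (x i * x j)
  hasDerivAt_fst : ∀ s ∈ U, HasDerivAt A (A' s) s
  hasDerivAt_snd : ∀ s ∈ U, HasDerivAt B (B' s) s
  fst_ne_zero : ∀ s ∈ U, A s ≠ 0
  radial_ne_zero : ∀ s ∈ U, A s + s * B s ≠ 0

/-- The function `P` in the Christoffel symbols
`Γ^k_ij = P (x_i δ_jk + x_j δ_ik) + Q x_k δ_ij + R x_i x_j x_k` of a radial metric. -/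
def radialP (A A' : ℝ → ℝ) (s : ℝ) : ℝ := A' s / A s

/-- The function `Q` in the Christoffel symbols of a radial metric. -/
def radialQ (A A' B : ℝ → ℝ) (s : ℝ) : ℝ := (B s - A' s) / (A s + s * B s)

/-- The function `R` in the Christoffel symbols of a radial metric. -/
def radialR (A A' B B' : ℝ → ℝ) (s : ℝ) : ℝ := (B' s - 2 * A' s * B s / A s) / (A s + s * B s)

namespace IsRadialMetric

variable {g : M → M → M → ℝ} {x₀ : M} {e : ι → M} {U : Set ℝ} {A A' B B' : ℝ → ℝ}

theorem eventually_mem (hg : IsRadialMetric g x₀ e U A A' B B') {x : ι → ℝ} (hx : sqNorm x ∈ U) :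
    ∀ᶠ y in 𝓝 x, sqNorm y ∈ U :=
  continuous_sqNorm.continuousAt.eventually (hg.isOpen.mem_nhds hx)

theorem inv_metricMatrix (hg : IsRadialMetric g x₀ e U A A' B B') {x : ι → ℝ} (hx : sqNorm x ∈ U)
    (i j : ι) :
    (metricMatrix g e (affineChart x₀ e x))⁻¹ i j = 1 / A (sqNorm x) * (kron i j
      - B (sqNorm x) / (A (sqNorm x) + sqNorm x * B (sqNorm x)) * (x i * x j)) := by
  have hA := hg.fst_ne_zero _ hx
  have hD := hg.radial_ne_zero _ hx
  have key : (metricMatrix g e (affineChart x₀ e x))⁻¹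
      = Matrix.of fun i j => 1 / A (sqNorm x) * (kron i j
      - B (sqNorm x) / (A (sqNorm x) + sqNorm x * B (sqNorm x)) * (x i * x j)) := by
    refine Matrix.inv_eq_right_inv ?_
    ext k l
    have hs : ∑ j, x j * x j = sqNorm x := by simp [sqNorm, sq]
    simp only [Matrix.mul_apply, metricMatrix, Matrix.of_apply, hg.apply x hx, Matrix.one_apply]
    have : ∀ j, (A (sqNorm x) * kron k j + B (sqNorm x) * (x k * x j)) * (1 / A (sqNorm x) *
        (kron j l - B (sqNorm x) / (A (sqNorm x) + sqNorm x * B (sqNorm x)) * (x j * x l)))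
        = kron k j * kron j l
          - B (sqNorm x) / (A (sqNorm x) + sqNorm x * B (sqNorm x)) * x l * (kron k j * x j)
          + B (sqNorm x) / A (sqNorm x) * x k * (x j * kron j l)
          - B (sqNorm x) ^ 2 / A (sqNorm x) / (A (sqNorm x) + sqNorm x * B (sqNorm x)) * x k * x l
            * (x j * x j) := by
      intro j; field_simp; ring
    simp only [this, Finset.sum_add_distrib, Finset.sum_sub_distrib, ← Finset.mul_sum, hs]
    simp only [kron, ite_mul, one_mul, zero_mul, Finset.sum_ite_eq, Finset.mem_univ, if_true,
      mul_ite, mul_one, mul_zero, Finset.sum_ite_eq']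
    generalize hDe : A (sqNorm x) + sqNorm x * B (sqNorm x) = D at hD
    field_simp
    rw [← hDe]
    ring
  rw [key, Matrix.of_apply]

theorem lineDeriv_metricMatrix (hg : IsRadialMetric g x₀ e U A A' B B') {x : ι → ℝ}
    (hx : sqNorm x ∈ U) (i j l : ι) :
    lineDeriv ℝ (fun y => metricMatrix g e y i j) (affineChart x₀ e x) (e l)
      = 2 * A' (sqNorm x) * x l * kron i j + 2 * B' (sqNorm x) * x l * (x i * x j)
        + B (sqNorm x) * (kron l i * x j + x i * kron l j) := by
  refine lineDeriv_affineChart (Φ := fun x => A (sqNorm x) * kron i j + B (sqNorm x) * (x i * x j))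
    ((hg.eventually_mem hx).mono fun y hy => hg.apply y hy i j) ?_
  have h1 := (hasDerivAt_comp_sqNorm (hg.hasDerivAt_fst _ hx) l).mul_const (kron i j)
  have h2 := (hasDerivAt_comp_sqNorm (hg.hasDerivAt_snd _ hx) l).fun_mul
    ((hasDerivAt_coord x l i).fun_mul (hasDerivAt_coord x l j))
  refine (h1.fun_add h2).congr_deriv ?_
  simp
  ring

theorem christoffel_eq (hg : IsRadialMetric g x₀ e U A A' B B') {x : ι → ℝ}
    (hx : sqNorm x ∈ U) (k i j : ι) :
    christoffel g e k i j (affineChart x₀ e x)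
      = radialP A A' (sqNorm x) * (x i * kron j k + x j * kron i k)
        + radialQ A A' B (sqNorm x) * (x k * kron i j)
        + radialR A A' B B' (sqNorm x) * (x i * x j * x k) := by
  have hA := hg.fst_ne_zero _ hx
  have hD := hg.radial_ne_zero _ hx
  have hs : ∑ j, x j * x j = sqNorm x := by simp [sqNorm, sq]
  simp only [christoffel, hg.inv_metricMatrix hx, hg.lineDeriv_metricMatrix hx,
    radialP, radialQ, radialR]
  generalize sqNorm x = s at *
  generalize A s = a at *
  generalize A' s = a' at *
  generalize B s = b at *
  generalize B' s = b' at *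
  have hk : ∀ i j : ι, kron j i = kron i j := fun i j => by simp [kron, eq_comm]
  have : ∀ l, 1 / a * (kron k l - b / (a + s * b) * (x k * x l)) *
      (2 * a' * x i * kron j l + 2 * b' * x i * (x j * x l) + b * (kron i j * x l + x j * kron i l)
        + (2 * a' * x j * kron i l + 2 * b' * x j * (x i * x l)
          + b * (kron j i * x l + x i * kron j l))
        - (2 * a' * x l * kron i j + 2 * b' * x l * (x i * x j)
          + b * (kron l i * x j + x i * kron l j)))
      = 2 / a * (a' * x i * (kron k l * kron j l) + a' * x j * (kron k l * kron i l)
          + (b' * x i * x j + (b - a') * kron i j) * (kron k l * x l)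
        - b / (a + s * b) * x k * (a' * x i * (x l * kron j l) + a' * x j * (x l * kron i l)
          + (b' * x i * x j + (b - a') * kron i j) * (x l * x l))) := by
    intro l
    rw [hk i l, hk j l, hk i j]
    ring
  simp only [this, Finset.sum_add_distrib, Finset.sum_sub_distrib, ← Finset.mul_sum, hs]
  have e1 : ∀ i j : ι, ∑ l, kron i l * kron j l = kron j i := fun i j => by
    simp only [kron, ite_mul, one_mul, zero_mul, Finset.sum_ite_eq, Finset.mem_univ, if_true]
  have e2 : ∀ i : ι, ∑ l, kron i l * x l = x i := fun i => by simp [kron]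
  have e3 : ∀ i : ι, ∑ l, x l * kron i l = x i := fun i => by simp [kron]
  simp only [e1, e2, e3]
  generalize hDe : a + s * b = D at hD
  field_simp
  rw [← hDe]
  ring

theorem lineDeriv_christoffel (hg : IsRadialMetric g x₀ e U A A' B B') {x : ι → ℝ}
    (hx : sqNorm x ∈ U) {P' Q' R' : ℝ} (hP : HasDerivAt (radialP A A') P' (sqNorm x))
    (hQ : HasDerivAt (radialQ A A' B) Q' (sqNorm x))
    (hR : HasDerivAt (radialR A A' B B') R' (sqNorm x)) (k i j l : ι) :
    lineDeriv ℝ (christoffel g e k i j) (affineChart x₀ e x) (e l)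
      = 2 * P' * x l * (x i * kron j k + x j * kron i k)
        + radialP A A' (sqNorm x) * (kron l i * kron j k + kron l j * kron i k)
        + 2 * Q' * x l * (x k * kron i j) + radialQ A A' B (sqNorm x) * (kron l k * kron i j)
        + 2 * R' * x l * (x i * x j * x k) + radialR A A' B B' (sqNorm x)
          * (kron l i * x j * x k + x i * kron l j * x k + x i * x j * kron l k) := by
  refine lineDeriv_affineChart
    ((hg.eventually_mem hx).mono fun y hy => hg.christoffel_eq hy k i j) ?_
  have c := hasDerivAt_coord x l
  have h1 := (hasDerivAt_comp_sqNorm hP l).fun_mul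
    (((c i).mul_const (kron j k)).fun_add ((c j).mul_const (kron i k)))
  have h2 := (hasDerivAt_comp_sqNorm hQ l).fun_mul ((c k).mul_const (kron i j))
  have h3 := (hasDerivAt_comp_sqNorm hR l).fun_mul (((c i).fun_mul (c j)).fun_mul (c k))
  refine ((h1.fun_add h2).fun_add h3).congr_deriv ?_
  simp
  ring

/-- The Ricci tensor of a three-dimensional radial metric is again of the form `α δ_kj + β x_k x_j`.
The second derivative of `B` enters only through `R'`, which cancels. -/
theorem ricciTensor_eq (hg : IsRadialMetric g x₀ e U A A' B B') (ε : Fin 3 ≃ ι) {x : ι → ℝ}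
    (hx : sqNorm x ∈ U) {P' Q' R' : ℝ} (hP : HasDerivAt (radialP A A') P' (sqNorm x))
    (hQ : HasDerivAt (radialQ A A' B) Q' (sqNorm x))
    (hR : HasDerivAt (radialR A A' B B') R' (sqNorm x)) {s P Q R : ℝ} (hs : s = sqNorm x)
    (hPs : P = radialP A A' s) (hQs : Q = radialQ A A' B s)
    (hRs : R = radialR A A' B B' s) (k j : ι) :
    ricciTensor g e k j (affineChart x₀ e x)
      = (-2 * P + 2 * Q - s * R + 2 * s * Q' + s * Q * (2 * P + Q + s * R)) * kron k j
        + (-4 * P' - 2 * Q' + 3 * R + 2 * P ^ 2 + 2 * s * P * R - Q ^ 2 - s * Q * R)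
          * (x k * x j) := by
  subst hs
  simp only [ricciTensor, riemannTensor, hg.lineDeriv_christoffel hx hP hQ hR,
    hg.christoffel_eq hx, ← hPs, ← hQs, ← hRs]
  have h3 : sqNorm x = x (ε 0) ^ 2 + x (ε 1) ^ 2 + x (ε 2) ^ 2 := by
    rw [sqNorm, ← ε.sum_comp, Fin.sum_univ_three]
  have hk : ∀ a b : Fin 3, kron (ε a) (ε b) = kron a b := fun a b => by simp [kron]
  obtain ⟨k, rfl⟩ := ε.surjective k
  obtain ⟨j, rfl⟩ := ε.surjective j
  simp only [← ε.sum_comp, Fin.sum_univ_three, hk]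
  rw [h3]
  clear hPs hQs hRs hP hQ hR h3 hx hk
  fin_cases k <;> fin_cases j <;> simp [kron] <;> ring

/-- The trace `2 α / A + (α + s β) / (A + s B)` of the Ricci tensor `α δ_kj + β x_k x_j`. -/
theorem scalarCurvature_eq (hg : IsRadialMetric g x₀ e U A A' B B') (ε : Fin 3 ≃ ι) {x : ι → ℝ}
    (hx : sqNorm x ∈ U) {P' Q' R' : ℝ} (hP : HasDerivAt (radialP A A') P' (sqNorm x))
    (hQ : HasDerivAt (radialQ A A' B) Q' (sqNorm x))
    (hR : HasDerivAt (radialR A A' B B') R' (sqNorm x)) {s P Q R : ℝ} (hs : s = sqNorm x)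
    (hPs : P = radialP A A' s) (hQs : Q = radialQ A A' B s)
    (hRs : R = radialR A A' B B' s) :
    scalarCurvature g e (affineChart x₀ e x)
      = 2 * (-2 * P + 2 * Q - s * R + 2 * s * Q' + s * Q * (2 * P + Q + s * R)) / A s
        + (-2 * P + 2 * Q - s * R + 2 * s * Q' + s * Q * (2 * P + Q + s * R)
          + s * (-4 * P' - 2 * Q' + 3 * R + 2 * P ^ 2 + 2 * s * P * R - Q ^ 2 - s * Q * R))
          / (A s + s * B s) := by
  have hA := hg.fst_ne_zero _ hx
  have hD := hg.radial_ne_zero _ hx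
  have h3 : s = x (ε 0) ^ 2 + x (ε 1) ^ 2 + x (ε 2) ^ 2 := by
    rw [hs, sqNorm, ← ε.sum_comp, Fin.sum_univ_three]
  simp only [scalarCurvature, hg.ricciTensor_eq ε hx hP hQ hR hs hPs hQs hRs,
    hg.inv_metricMatrix hx]
  rw [← hs] at hA hD ⊢
  generalize -2 * P + 2 * Q - s * R + 2 * s * Q' + s * Q * (2 * P + Q + s * R) = α
  generalize -4 * P' - 2 * Q' + 3 * R + 2 * P ^ 2 + 2 * s * P * R - Q ^ 2 - s * Q * R = β
  generalize A s = a at *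
  generalize B s = b at *
  have hk : ∀ a b : Fin 3, kron (ε a) (ε b) = kron a b := fun a b => by simp [kron]
  simp only [← ε.sum_comp, Fin.sum_univ_three, hk]
  clear hs hPs hQs hRs
  generalize hDe : a + s * b = D at hD
  have hae : a = D - s * b := by linarith
  simp [kron]
  field_simp
  rw [← hDe, h3]
  ring

end IsRadialMetric
end RadialMetric

/-! ### Monotone metrics in Bloch coordinates -/

/-- If `c(x, y)` agrees on the spectrum of `ρ` with the polynomial `k₀ + k₁ (x + y) + k₂ x y`, then
`c(L_ρ, R_ρ)` is that polynomial in `L_ρ` and `R_ρ`. This removes the eigenvectors from the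
calculus. -/
theorem leftRightCalculus_eq_of_bilinear {n : ℕ} {c : ℝ → ℝ → ℝ} {ρ : Matrix (Fin n) (Fin n) ℂ}
    (hρ : ρ.IsHermitian) {k₀ k₁ k₂ : ℝ}
    (h : ∀ i j, c (hρ.eigenvalues i) (hρ.eigenvalues j) = k₀
      + k₁ * (hρ.eigenvalues i + hρ.eigenvalues j) + k₂ * (hρ.eigenvalues i * hρ.eigenvalues j))
    (B : Matrix (Fin n) (Fin n) ℂ) :
    leftRightCalculus c ρ B
      = (k₀ : ℂ) • B + (k₁ : ℂ) • (ρ * B + B * ρ) + (k₂ : ℂ) • (ρ * B * ρ) := by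
  rw [leftRightCalculus, dif_pos hρ]
  set U : Matrix (Fin n) (Fin n) ℂ := (hρ.eigenvectorUnitary : Matrix (Fin n) (Fin n) ℂ) with hU
  set D : Matrix (Fin n) (Fin n) ℂ := Matrix.diagonal fun i => (hρ.eigenvalues i : ℂ) with hD
  have hUU : U * U.conjTranspose = 1 := Matrix.mem_unitaryGroup_iff.1 hρ.eigenvectorUnitary.2
  have hsp : ρ = U * D * U.conjTranspose := by
    have := hρ.spectral_theorem
    simpa [Unitary.conjStarAlgAut_apply, Function.comp_def, Matrix.star_eq_conjTranspose] using this
  have hX : (Matrix.of fun i j => (c (hρ.eigenvalues i) (hρ.eigenvalues j) : ℂ)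
      * (U.conjTranspose * B * U) i j)
      = (k₀ : ℂ) • (U.conjTranspose * B * U) + (k₁ : ℂ) • (D * (U.conjTranspose * B * U)
        + (U.conjTranspose * B * U) * D) + (k₂ : ℂ) • (D * (U.conjTranspose * B * U) * D) := by
    ext i j
    rw [Matrix.of_apply, h]
    simp only [Matrix.add_apply, Matrix.smul_apply, hD, Matrix.diagonal_mul, Matrix.mul_diagonal,
      smul_eq_mul]
    push_cast
    ring
  have e1 : U * D * U.conjTranspose * B * (U * U.conjTranspose)
    = U * (D * (U.conjTranspose * B * U)) * U.conjTranspose := by simp only [Matrix.mul_assoc]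
  have e2 : (U * U.conjTranspose) * B * (U * D * U.conjTranspose)
    = U * ((U.conjTranspose * B * U) * D) * U.conjTranspose := by simp only [Matrix.mul_assoc]
  have e3 : (U * D * U.conjTranspose) * B * (U * D * U.conjTranspose)
    = U * (D * (U.conjTranspose * B * U) * D) * U.conjTranspose := by simp only [Matrix.mul_assoc]
  have e0 : (U * U.conjTranspose) * B * (U * U.conjTranspose)
    = U * (U.conjTranspose * B * U) * U.conjTranspose := by simp only [Matrix.mul_assoc]
  rw [hUU, ← hsp, Matrix.mul_one] at e1
  rw [hUU, ← hsp, Matrix.one_mul] at e2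
  rw [← hsp] at e3
  rw [hUU, Matrix.mul_one, Matrix.one_mul] at e0
  change U * _ * U.conjTranspose = _
  rw [hX, e3, e1, e2]
  simp only [Matrix.mul_add, Matrix.add_mul, Matrix.mul_smul, Matrix.smul_mul]
  rw [← e0]

/-- The enumeration of `FrameIndex 2` for which `tracelessFrame 2` is `σ_x, σ_y, σ_z`. -/
def pauliEquiv : Fin 3 ≃ FrameIndex 2 where
  toFun := ![⟨(0, 1), by decide⟩, ⟨(1, 0), by decide⟩, ⟨(0, 0), by decide⟩]
  invFun q := if q.1 = (0, 1) then 0 else if q.1 = (1, 0) then 1 else 2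
  left_inv := by decide
  right_inv := by decide

theorem tracelessFrame_pauli_zero : tracelessFrame 2 (pauliEquiv 0) = !![0, 1; 1, 0] := by
  ext i j
  fin_cases i <;> fin_cases j <;> simp [tracelessFrame, pauliEquiv]

theorem tracelessFrame_pauli_one :
    tracelessFrame 2 (pauliEquiv 1) = !![0, -Complex.I; Complex.I, 0] := by
  ext i j
  fin_cases i <;> fin_cases j <;> simp [tracelessFrame, pauliEquiv]

theorem tracelessFrame_pauli_two : tracelessFrame 2 (pauliEquiv 2) = !![1, 0; 0, -1] := by
  ext i j
  fin_cases i <;> fin_cases j <;> simp [tracelessFrame, pauliEquiv]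

/-- The matrix `1 / 2 + x σ_x + y σ_y + z σ_z`, whose eigenvalues are `1 / 2 ± |(x, y, z)|`. -/
def blochMatrix (x : FrameIndex 2 → ℝ) : Matrix (Fin 2) (Fin 2) ℂ :=
  affineChart ((1 / 2 : ℝ) • (1 : Matrix (Fin 2) (Fin 2) ℂ)) (tracelessFrame 2) x

theorem blochMatrix_eq (x : FrameIndex 2 → ℝ) :
    blochMatrix x = !![(1 / 2 + x (pauliEquiv 2) : ℂ),
        (x (pauliEquiv 0) - x (pauliEquiv 1) * Complex.I : ℂ);
      (x (pauliEquiv 0) + x (pauliEquiv 1) * Complex.I : ℂ),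
        (1 / 2 - x (pauliEquiv 2) : ℂ)] := by
  rw [blochMatrix, affineChart, ← pauliEquiv.sum_comp, Fin.sum_univ_three,
    tracelessFrame_pauli_zero, tracelessFrame_pauli_one, tracelessFrame_pauli_two]
  ext i j
  fin_cases i <;> fin_cases j <;> simp [sub_eq_add_neg]

theorem sqNorm_pauli (x : FrameIndex 2 → ℝ) :
    sqNorm x = x (pauliEquiv 0) ^ 2 + x (pauliEquiv 1) ^ 2 + x (pauliEquiv 2) ^ 2 := by
  rw [sqNorm, ← pauliEquiv.sum_comp, Fin.sum_univ_three]

theorem isHermitian_blochMatrix (x : FrameIndex 2 → ℝ) : (blochMatrix x).IsHermitian := by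
  rw [blochMatrix_eq, Matrix.IsHermitian]
  ext i j
  fin_cases i <;> fin_cases j <;> simp [Matrix.conjTranspose_apply, sub_eq_add_neg]

theorem det_blochMatrix (x : FrameIndex 2 → ℝ) :
    (blochMatrix x).det = ((1 / 4 - sqNorm x : ℝ) : ℂ) := by
  rw [blochMatrix_eq, Matrix.det_fin_two_of, sqNorm_pauli]
  push_cast
  linear_combination (x (pauliEquiv 1) : ℂ) ^ 2 * Complex.I_sq

theorem trace_blochMatrix (x : FrameIndex 2 → ℝ) : (blochMatrix x).trace = 1 := by
  rw [blochMatrix_eq, Matrix.trace_fin_two_of]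
  ring

theorem eigenvalues_blochMatrix (x : FrameIndex 2 → ℝ) (h : (blochMatrix x).IsHermitian) :
    h.eigenvalues 0 + h.eigenvalues 1 = 1 ∧
      h.eigenvalues 0 * h.eigenvalues 1 = 1 / 4 - sqNorm x := by
  have h1 := h.trace_eq_sum_eigenvalues
  have h2 := h.det_eq_prod_eigenvalues
  rw [trace_blochMatrix, Fin.sum_univ_two] at h1
  rw [det_blochMatrix, Fin.prod_univ_two] at h2
  constructor
  · exact Complex.ofReal_injective (by push_cast; exact h1.symm)
  · exact Complex.ofReal_injective (by push_cast; push_cast at h2; exact h2.symm)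

theorem sq_hermEigenvalues_blochMatrix (x : FrameIndex 2 → ℝ) (i : Fin 2) :
    (2 * hermEigenvalues (blochMatrix x) i - 1) ^ 2 = 4 * sqNorm x := by
  have h := isHermitian_blochMatrix x
  obtain ⟨h1, h2⟩ := eigenvalues_blochMatrix x h
  rw [hermEigenvalues, dif_pos h]
  fin_cases i
  · have : h.eigenvalues 1 = 1 - h.eigenvalues 0 := by linarith
    rw [this] at h2
    simp only [Fin.zero_eta]
    linarith
  · have : h.eigenvalues 0 = 1 - h.eigenvalues 1 := by linarith
    rw [this] at h2
    simp only [Fin.mk_one]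
    linarith

open scoped ComplexOrder in
theorem exists_blochMatrix {ρ : Matrix (Fin 2) (Fin 2) ℂ} (hρ : ρ ∈ densityMatrices 2) :
    ∃ x : FrameIndex 2 → ℝ, sqNorm x < 1 / 4 ∧ blochMatrix x = ρ := by
  obtain ⟨hp, ht⟩ := hρ
  refine ⟨fun q => ![(ρ 0 1).re, -(ρ 0 1).im, (ρ 0 0).re - 1 / 2] (pauliEquiv.symm q), ?_⟩
  have e : blochMatrix (fun q => ![(ρ 0 1).re, -(ρ 0 1).im, (ρ 0 0).re - 1 / 2]
      (pauliEquiv.symm q)) = ρ := by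
    have h00 := hp.1.apply 0 0
    have h10 := hp.1.apply 1 0
    rw [Matrix.trace_fin_two] at ht
    have h0 : (ρ 0 0).im = 0 := by
      have := congrArg Complex.im h00; simp at this; linarith
    rw [blochMatrix_eq]
    ext i j
    fin_cases i <;> fin_cases j <;> apply Complex.ext <;> simp [← h10, h0]
    · have := congrArg Complex.re ht; simp at this; linarith
    · have := congrArg Complex.im ht; simp at this; linarith
  refine ⟨?_, e⟩
  have hdet := hp.det_pos
  rw [← e, det_blochMatrix] at hdet
  have := (Complex.lt_def.1 hdet).1
  simp only [Complex.zero_re, Complex.ofReal_re] at this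
  linarith

theorem diagonal_eq_blochMatrix (a : ℝ) :
    Matrix.diagonal ![(((1 + a) / 2 : ℝ) : ℂ), (((1 - a) / 2 : ℝ) : ℂ)]
      = blochMatrix (fun q => ![0, 0, a / 2] (pauliEquiv.symm q)) := by
  rw [blochMatrix_eq]
  ext i j
  fin_cases i <;> fin_cases j <;> simp <;> ring

/-- A monotone metric on the `2 × 2` density matrices is radial in the Bloch coordinates. Its radial
part `1 / (1 / 4 - |x| ^ 2)` does not depend on `f`, and its transversal part is twice the value of
the Chentsov–Morozova function at the two eigenvalues. -/
theorem monotoneMetric_blochMatrix {f : ℝ → ℝ} (hf1 : f 1 = 1) {x : FrameIndex 2 → ℝ}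
    (hx : sqNorm x < 1 / 4) {A B : ℝ} (hrad : A + sqNorm x * B = 1 / (1 / 4 - sqNorm x))
    (htan : ∀ κ : ℝ, κ ^ 2 = sqNorm x → chentsovMorozova f (1 / 2 + κ) (1 / 2 - κ) = A / 2)
    (q r : FrameIndex 2) :
    monotoneMetric f (blochMatrix x) (tracelessFrame 2 q) (tracelessFrame 2 r)
      = A * kron q r + B * (x q * x r) := by
  have h := isHermitian_blochMatrix x
  obtain ⟨h1, h2⟩ := eigenvalues_blochMatrix x h
  have hpos : 0 < 1 / 4 - sqNorm x := by linarith
  have hdiag : ∀ l : ℝ, l * (1 - l) = 1 / 4 - sqNorm x →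
      chentsovMorozova f l l = 1 / (1 / 4 - sqNorm x) * (1 - l) := by
    intro l hl
    have hl0 : l ≠ 0 := by rintro rfl; linarith
    have hl1 : 1 - l ≠ 0 := by intro h; rw [h] at hl; linarith
    rw [chentsovMorozova, div_self hl0, hf1, ← hl]
    field_simp
  have hoff : ∀ l : ℝ, l * (1 - l) = 1 / 4 - sqNorm x →
      chentsovMorozova f l (1 - l) = A / 2 := by
    intro l hl
    have := htan (l - 1 / 2) (by linarith)
    convert this using 2 <;> ring
  set K : ℝ := 1 / (1 / 4 - sqNorm x) with hK
  set δ : ℝ := 1 / 4 - sqNorm x with hδ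
  have hs : sqNorm x = 1 / 4 - δ := by rw [hδ]; ring
  -- The coefficients solve the three linear equations for the values of `c_f` at the pairs of
  -- eigenvalues; written in terms of `B`, they stay valid when the two eigenvalues coincide.
  have hc : ∀ i j, chentsovMorozova f (h.eigenvalues i) (h.eigenvalues j)
      = (K * (3 / 4) + A / 4 + B / 16) + (-K / 2 - B / 8) * (h.eigenvalues i + h.eigenvalues j)
        + B / 4 * (h.eigenvalues i * h.eigenvalues j) := by
    have a0 : h.eigenvalues 1 = 1 - h.eigenvalues 0 := by linarith
    have a1 : h.eigenvalues 0 = 1 - h.eigenvalues 1 := by linarith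
    have b0 : h.eigenvalues 0 * (1 - h.eigenvalues 0) = δ := by rw [← a0]; exact h2
    have b1 : h.eigenvalues 1 * (1 - h.eigenvalues 1) = δ := by rw [← a1, mul_comm]; exact h2
    rw [hs] at hrad
    intro i j
    fin_cases i <;> fin_cases j <;> simp only [Fin.zero_eta, Fin.mk_one]
    · rw [hdiag _ b0]; linear_combination (-1 / 4) * hrad + (B / 4) * b0
    · rw [a0, hoff _ b0]; linear_combination (1 / 4) * hrad - (B / 4) * b0
    · rw [a1, hoff _ b1]; linear_combination (1 / 4) * hrad - (B / 4) * b1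
    · rw [hdiag _ b1]; linear_combination (-1 / 4) * hrad + (B / 4) * b1
  rw [monotoneMetric, leftRightCalculus_eq_of_bilinear h hc]
  obtain ⟨q, rfl⟩ := pauliEquiv.surjective q
  obtain ⟨r, rfl⟩ := pauliEquiv.surjective r
  have hk : kron (pauliEquiv q) (pauliEquiv r) = kron q r := by simp [kron]
  rw [hk]
  rw [sqNorm_pauli] at hrad
  rw [blochMatrix_eq]
  clear_value K δ
  fin_cases q <;> fin_cases r <;>
    simp [kron, tracelessFrame_pauli_zero, tracelessFrame_pauli_one, tracelessFrame_pauli_two,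
      Matrix.trace_fin_two]
  all_goals first
    | ring1
    | linear_combination (-1 / 2) * hrad

/-! ### The Chentsov–Morozova function of the WYD metric -/

theorem cothSeries_rpow_of_abs_le {b : ℝ} (h0 : 0 ≤ b) (h1 : b ≤ 1) {r : ℝ} (hr : |r| ≤ 1) :
    ((1 + r) ^ b - (1 - r) ^ b) * (1 - r ^ 2 * cothSeries b (r ^ 2))
      = b * r * ((1 + r) ^ b + (1 - r) ^ b) := by
  rcases le_total 0 r with h | h
  · exact cothSeries_rpow h0 h1 ⟨h, le_of_abs_le hr⟩
  · have := cothSeries_rpow h0 h1 (r := -r) ⟨by linarith, by linarith [neg_le_of_abs_le hr]⟩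
    rw [neg_sq, sub_neg_eq_add, ← sub_eq_add_neg] at this
    linear_combination -this

/-- The combination of `φ_a` and `φ_{1 - a}` for which
`1 - s cothMean a s = a (1 - a) r (coth (a v) + coth ((1 - a) v))`, where `s = r ^ 2` and
`r = tanh v`. -/
def cothMean (a s : ℝ) : ℝ := (1 - a) * cothSeries a s + a * cothSeries (1 - a) s

theorem abs_cothMean_le_one {a : ℝ} (ha : a ∈ Set.Icc (0 : ℝ) 1) {s : ℝ} (hs : |s| ≤ 1) :
    |cothMean a s| ≤ 1 := by
  have h1 := abs_le.1 (abs_cothSeries_le_one ha.1 ha.2 hs)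
  have h2 := abs_le.1 (abs_cothSeries_le_one (b := 1 - a) (by linarith [ha.2])
    (by linarith [ha.1]) hs)
  have := ha.1
  have := ha.2
  rw [cothMean, abs_le]
  constructor <;> nlinarith

theorem one_sub_mul_cothMean_pos {a : ℝ} (ha : a ∈ Set.Icc (0 : ℝ) 1) {s : ℝ} (hs : |s| < 1) :
    0 < 1 - s * cothMean a s := by
  have h : |s * cothMean a s| < 1 := by
    rw [abs_mul]
    exact (mul_le_of_le_one_right (abs_nonneg s) (abs_cothMean_le_one ha hs.le)).trans_lt hs
  linarith [(abs_lt.1 h).2]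

theorem rpow_mul_rpow_one_sub {x : ℝ} (hx : 0 < x) (a : ℝ) : x ^ a * x ^ (1 - a) = x := by
  rw [← Real.rpow_add hx, add_sub_cancel, Real.rpow_one]

theorem mul_one_sub_mul_cothMean {a : ℝ} (ha : a ∈ Set.Icc (0 : ℝ) 1) {r : ℝ} (hr : |r| < 1) :
    ((1 + r) ^ a - (1 - r) ^ a) * ((1 + r) ^ (1 - a) - (1 - r) ^ (1 - a))
      * (1 - r ^ 2 * cothMean a (r ^ 2)) = 4 * a * (1 - a) * r ^ 2 := by
  have h1 := cothSeries_rpow_of_abs_le ha.1 ha.2 hr.le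
  have h2 := cothSeries_rpow_of_abs_le (b := 1 - a) (by linarith [ha.2]) (by linarith [ha.1]) hr.le
  have hp := rpow_mul_rpow_one_sub (x := 1 + r) (by linarith [neg_lt_of_abs_lt hr]) a
  have hq := rpow_mul_rpow_one_sub (x := 1 - r) (by linarith [lt_of_abs_lt hr]) a
  rw [cothMean]
  linear_combination (1 - a) * ((1 + r) ^ (1 - a) - (1 - r) ^ (1 - a)) * h1
    + a * ((1 + r) ^ a - (1 - r) ^ a) * h2 + 2 * a * (1 - a) * r * (hp - hq)

theorem rpow_sub_rpow_ne_zero {a : ℝ} (ha : 0 < a) {r : ℝ} (hr : |r| < 1) (hr0 : r ≠ 0) :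
    (1 + r) ^ a - (1 - r) ^ a ≠ 0 := by
  intro h
  have := (Real.rpow_left_inj (by linarith [neg_lt_of_abs_lt hr]) (by linarith [lt_of_abs_lt hr])
    ha.ne').1 (sub_eq_zero.1 h)
  exact hr0 (by linarith)

/-- The addition theorem for `coth`: `coth (a v)` and `coth ((1 - a) v)` determine
`coth v = 1 / r`. -/
theorem coth_addition {a : ℝ} (ha : a ∈ Set.Ioo (0 : ℝ) 1) {s : ℝ} (hs : s ∈ Set.Ioo (0 : ℝ) 1) :
    (1 - s * cothSeries a s) * (1 - s * cothSeries (1 - a) s) + a * (1 - a) * s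
      = 1 - s * cothMean a s := by
  set r := √s with hr
  have hrs : r ^ 2 = s := Real.sq_sqrt hs.1.le
  have hr0 : 0 < r := Real.sqrt_pos.2 hs.1
  have hr1 : |r| < 1 := by
    rw [abs_of_pos hr0]
    nlinarith [hs.2]
  have h1 := cothSeries_rpow_of_abs_le ha.1.le ha.2.le hr1.le
  have h2 := cothSeries_rpow_of_abs_le (b := 1 - a) (by linarith [ha.2]) (by linarith [ha.1])
    hr1.le
  have hm := mul_one_sub_mul_cothMean ⟨ha.1.le, ha.2.le⟩ hr1
  have hp := rpow_mul_rpow_one_sub (x := 1 + r) (by linarith) a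
  have hq := rpow_mul_rpow_one_sub (x := 1 - r) (by linarith [lt_of_abs_lt hr1]) a
  rw [hrs] at h1 h2 hm
  have n1 := rpow_sub_rpow_ne_zero ha.1 hr1 hr0.ne'
  have n2 := rpow_sub_rpow_ne_zero (a := 1 - a) (by linarith [ha.2]) hr1 hr0.ne'
  refine mul_left_cancel₀ (mul_ne_zero n1 n2) ?_
  rw [hm]
  linear_combination ((1 + r) ^ (1 - a) - (1 - r) ^ (1 - a)) * (1 - s * cothSeries (1 - a) s) * h1
    + a * r * ((1 + r) ^ a + (1 - r) ^ a) * h2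
    + a * (1 - a) * (r ^ 2 + s) * (hp + hq) - a * (1 - a) * (2 - 4) * hrs
    + a * (1 - a) * ((1 + r) ^ a * (1 - r) ^ (1 - a) + (1 - r) ^ a * (1 + r) ^ (1 - a)) * hrs

/-- The Chentsov–Morozova function of the WYD metric at the eigenvalues `1 / 2 ± κ`, as a function
of `s = 4 κ ^ 2` that is analytic at `s = 0`. -/
theorem chentsovMorozova_wydFun {p : ℝ} (hp : p ∈ Set.Ioo (1 : ℝ) 2) {κ : ℝ} (hκ : κ ^ 2 < 1 / 4) :
    chentsovMorozova (wydFun p) (1 / 2 + κ) (1 / 2 - κ)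
      = 2 / (1 - 4 * κ ^ 2 * cothMean (1 / p) (4 * κ ^ 2)) := by
  have hp0 : 0 < p := by linarith [hp.1]
  set a := 1 / p with ha
  have ha0 : 0 < a := by positivity
  have ha1 : a < 1 := by rw [ha, div_lt_one hp0]; exact hp.1
  rcases eq_or_ne κ 0 with rfl | h0
  · norm_num [chentsovMorozova, wydFun]
  obtain ⟨r, rfl⟩ : ∃ r, κ = r / 2 := ⟨2 * κ, by ring⟩
  have hr0 : r ≠ 0 := by rintro rfl; simp at h0
  have hr1 : |r| < 1 := by
    rw [← sq_lt_one_iff_abs_lt_one]; linarith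
  have e4 : 4 * (r / 2) ^ 2 = r ^ 2 := by ring
  have hx : 0 < 1 + r := by linarith [neg_lt_of_abs_lt hr1]
  have hy : 0 < 1 - r := by linarith [lt_of_abs_lt hr1]
  have hm := mul_one_sub_mul_cothMean ⟨ha0.le, ha1.le⟩ hr1
  have hN := one_sub_mul_cothMean_pos ⟨ha0.le, ha1.le⟩ (s := r ^ 2)
    (by rw [abs_of_nonneg (sq_nonneg r)]; linarith)
  have n1 := rpow_sub_rpow_ne_zero ha0 hr1 hr0
  have n2 := rpow_sub_rpow_ne_zero (a := 1 - a) (by linarith) hr1 hr0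
  have hq := rpow_mul_rpow_one_sub hy a
  have ediv : (1 / 2 + r / 2) / (1 / 2 - r / 2) = (1 + r) / (1 - r) := by
    rw [← add_div, ← sub_div, div_div_div_cancel_right₀ two_ne_zero]
  have hne : (1 + r) / (1 - r) ≠ 1 := by
    rw [Ne, div_eq_one_iff_eq hy.ne']; intro h; exact hr0 (by linarith)
  have eq1 : 1 / (p / (p - 1)) = 1 - a := by
    rw [ha, one_div_div]; field_simp
  have eq2 : 1 / (p * (p / (p - 1))) = a * (1 - a) := by
    have : p - 1 ≠ 0 := by linarith [hp.1]
    rw [ha]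
    field_simp
  rw [chentsovMorozova, ediv, wydFun, if_neg hne, if_neg hp.1.ne', e4]
  simp only [eq1, eq2, ← ha]
  rw [Real.div_rpow hx.le hy.le, Real.div_rpow hx.le hy.le]
  have q1 : 0 < (1 - r) ^ a := Real.rpow_pos_of_pos hy _
  have q2 : 0 < (1 - r) ^ (1 - a) := Real.rpow_pos_of_pos hy _
  generalize (1 - r) ^ a = Q at *
  generalize (1 - r) ^ (1 - a) = Q' at *
  generalize (1 + r) ^ a = X at *
  generalize (1 + r) ^ (1 - a) = X' at *
  generalize 1 - r ^ 2 * cothMean a (r ^ 2) = N at *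
  have hb : 1 - a ≠ 0 := by linarith
  have e5 : (1 / 2 - r / 2) * (a * (1 - a) * (((1 + r) / (1 - r) - 1) ^ 2
      / ((X / Q - 1) * (X' / Q' - 1)))) = N / 2 := by
    have e6 : (1 + r) / (1 - r) - 1 = 2 * r / (1 - r) := by field_simp; ring
    have e7 : (X / Q - 1) * (X' / Q' - 1) = (X - Q) * (X' - Q') / (1 - r) := by
      rw [← hq]; field_simp
    have e8 : (1 / 2 - r / 2) = (1 - r) / 2 := by ring
    rw [e6, e7, e8]
    field_simp
    linear_combination -hm
  rw [e5, one_div_div]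

/-! ### The curvature of the WYD metric -/

/-- The coefficient of `δ_ij` in the WYD metric in Bloch coordinates, as a function of
`σ = |x| ^ 2`; here `a = 1 / p`. -/
def wydTangential (a σ : ℝ) : ℝ := 4 / (1 - 4 * σ * cothMean a (4 * σ))

/-- The coefficient of `x_i x_j` in the WYD metric in Bloch coordinates, as a function of
`σ = |x| ^ 2`; here `a = 1 / p`. -/
def wydRadialPart (a σ : ℝ) : ℝ :=
  16 * (1 - cothMean a (4 * σ)) / ((1 - 4 * σ) * (1 - 4 * σ * cothMean a (4 * σ)))

theorem analyticAt_cothSeries_four_mul {b : ℝ} (h0 : 0 ≤ b) (h1 : b ≤ 1) {σ : ℝ}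
    (hσ : σ ∈ Set.Ioo (-1 / 4 : ℝ) (1 / 4)) : AnalyticAt ℝ (fun σ => cothSeries b (4 * σ)) σ := by
  have h : AnalyticAt ℝ (cothSeries b) (4 * σ) := analyticOnNhd_cothSeries h0 h1 _ (by
    rw [Metric.mem_ball, dist_zero_right, Real.norm_eq_abs, abs_lt]
    constructor <;> linarith [hσ.1, hσ.2])
  exact AnalyticAt.fun_comp (g := cothSeries b) (f := fun σ => 4 * σ) h (by fun_prop)

theorem analyticAt_cothMean_four_mul {a : ℝ} (ha : a ∈ Set.Ioo (0 : ℝ) 1) {σ : ℝ}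
    (hσ : σ ∈ Set.Ioo (-1 / 4 : ℝ) (1 / 4)) : AnalyticAt ℝ (fun σ => cothMean a (4 * σ)) σ := by
  have h1 := analyticAt_cothSeries_four_mul ha.1.le ha.2.le hσ
  have h2 := analyticAt_cothSeries_four_mul (b := 1 - a) (by linarith [ha.2])
    (by linarith [ha.1]) hσ
  unfold cothMean
  fun_prop

theorem wydDenom_pos {a : ℝ} (ha : a ∈ Set.Ioo (0 : ℝ) 1) {σ : ℝ}
    (hσ : σ ∈ Set.Ioo (-1 / 4 : ℝ) (1 / 4)) : 0 < 1 - 4 * σ * cothMean a (4 * σ) :=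
  one_sub_mul_cothMean_pos ⟨ha.1.le, ha.2.le⟩ (by
    rw [abs_lt]; constructor <;> linarith [hσ.1, hσ.2])

theorem analyticAt_wydTangential {a : ℝ} (ha : a ∈ Set.Ioo (0 : ℝ) 1) {σ : ℝ}
    (hσ : σ ∈ Set.Ioo (-1 / 4 : ℝ) (1 / 4)) : AnalyticAt ℝ (wydTangential a) σ := by
  have h := analyticAt_cothMean_four_mul ha hσ
  have hN := (wydDenom_pos ha hσ).ne'
  unfold wydTangential
  exact AnalyticAt.fun_div (by fun_prop) (by fun_prop) hN

theorem analyticAt_wydRadialPart {a : ℝ} (ha : a ∈ Set.Ioo (0 : ℝ) 1) {σ : ℝ}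
    (hσ : σ ∈ Set.Ioo (-1 / 4 : ℝ) (1 / 4)) : AnalyticAt ℝ (wydRadialPart a) σ := by
  have h := analyticAt_cothMean_four_mul ha hσ
  have hN := (wydDenom_pos ha hσ).ne'
  have hu : 1 - 4 * σ ≠ 0 := by linarith [hσ.2]
  unfold wydRadialPart
  exact AnalyticAt.fun_div (by fun_prop) (by fun_prop) (mul_ne_zero hu hN)

theorem wydTangential_add {a : ℝ} (ha : a ∈ Set.Ioo (0 : ℝ) 1) {σ : ℝ}
    (hσ : σ ∈ Set.Ioo (-1 / 4 : ℝ) (1 / 4)) :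
    wydTangential a σ + σ * wydRadialPart a σ = 1 / (1 / 4 - σ) := by
  have hN := (wydDenom_pos ha hσ).ne'
  have hu : 1 - 4 * σ ≠ 0 := by linarith [hσ.2]
  have e : (1 / 4 - σ) = (1 - 4 * σ) / 4 := by ring
  rw [wydTangential, wydRadialPart, e]
  field_simp
  ring

theorem isRadialMetric_wyd {p : ℝ} (hp : p ∈ Set.Ioo (1 : ℝ) 2) :
    IsRadialMetric (monotoneMetric (wydFun p)) ((1 / 2 : ℝ) • (1 : Matrix (Fin 2) (Fin 2) ℂ))
      (tracelessFrame 2) (Set.Ioo (-1 / 4) (1 / 4)) (wydTangential (1 / p))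
      (deriv (wydTangential (1 / p))) (wydRadialPart (1 / p)) (deriv (wydRadialPart (1 / p))) := by
  have ha : 1 / p ∈ Set.Ioo (0 : ℝ) 1 := by
    have : 0 < p := by linarith [hp.1]
    exact ⟨by positivity, by rw [div_lt_one this]; exact hp.1⟩
  refine ⟨isOpen_Ioo, fun x hx i j => ?_, fun s hs => ?_, fun s hs => ?_, fun s hs => ?_,
    fun s hs => ?_⟩
  · refine monotoneMetric_blochMatrix (by simp [wydFun]) hx.2 (wydTangential_add ha hx) ?_ i j
    intro κ hκ
    rw [chentsovMorozova_wydFun hp (hκ ▸ hx.2), hκ, wydTangential]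
    ring
  · exact (analyticAt_wydTangential ha hs).differentiableAt.hasDerivAt
  · exact (analyticAt_wydRadialPart ha hs).differentiableAt.hasDerivAt
  · exact div_ne_zero four_ne_zero (wydDenom_pos ha hs).ne'
  · rw [wydTangential_add ha hs]
    exact one_div_ne_zero (by linarith [hs.2])

/-- The scalar curvature of the WYD metric at a `2 × 2` density matrix with eigenvalues
`(1 ± √s) / 2`; here `a = 1 / p`. -/
def wydProfile (a s : ℝ) : ℝ :=
  3 / 2 - (3 / 2 * (2 * a - 1) ^ 2
    - s * ((2 * a - 1) * (cothSeries (1 - a) s - cothSeries a s)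
      + (cothSeries (1 - a) s - cothSeries a s) ^ 2 / 2)) / (1 - s)

/-- The expression for the scalar curvature of a three-dimensional radial metric with coefficients
`A` and `B`. -/
def radialScal (A B : ℝ → ℝ) (s : ℝ) : ℝ :=
  let P := radialP A (deriv A) s
  let Q := radialQ A (deriv A) B s
  let R := radialR A (deriv A) B (deriv B) s
  let P' := deriv (radialP A (deriv A)) s
  let Q' := deriv (radialQ A (deriv A) B) s
  2 * (-2 * P + 2 * Q - s * R + 2 * s * Q' + s * Q * (2 * P + Q + s * R)) / A s
    + (-2 * P + 2 * Q - s * R + 2 * s * Q' + s * Q * (2 * P + Q + s * R)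
      + s * (-4 * P' - 2 * Q' + 3 * R + 2 * P ^ 2 + 2 * s * P * R - Q ^ 2 - s * Q * R))
      / (A s + s * B s)

theorem AnalyticAt.radialP {A : ℝ → ℝ} {s : ℝ} (hA : AnalyticAt ℝ A s) (hA0 : A s ≠ 0) :
    AnalyticAt ℝ (radialP A (deriv A)) s :=
  hA.deriv.fun_div hA hA0

theorem AnalyticAt.radialQ {A B : ℝ → ℝ} {s : ℝ} (hA : AnalyticAt ℝ A s) (hB : AnalyticAt ℝ B s)
    (hD : A s + s * B s ≠ 0) : AnalyticAt ℝ (radialQ A (deriv A) B) s :=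
  (hB.fun_sub hA.deriv).fun_div (by fun_prop) hD

theorem AnalyticAt.radialR {A B : ℝ → ℝ} {s : ℝ} (hA : AnalyticAt ℝ A s) (hB : AnalyticAt ℝ B s)
    (hA0 : A s ≠ 0) (hD : A s + s * B s ≠ 0) :
    AnalyticAt ℝ (radialR A (deriv A) B (deriv B)) s := by
  have h1 := hA.deriv
  have h3 : AnalyticAt ℝ (fun s => 2 * deriv A s * B s / A s) s :=
    AnalyticAt.fun_div (by fun_prop) hA hA0
  exact (hB.deriv.fun_sub h3).fun_div (by fun_prop) hD

theorem AnalyticAt.continuousAt_radialScal {A B : ℝ → ℝ} {s : ℝ} (hA : AnalyticAt ℝ A s)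
    (hB : AnalyticAt ℝ B s) (hA0 : A s ≠ 0) (hD : A s + s * B s ≠ 0) :
    ContinuousAt (radialScal A B) s := by
  have c1 := hA.continuousAt
  have c2 := hB.continuousAt
  have c3 := (hA.radialP hA0).continuousAt
  have c4 := (hA.radialQ hB hD).continuousAt
  have c5 := (hA.radialR hB hA0 hD).continuousAt
  have c6 := (hA.radialP hA0).deriv.continuousAt
  have c7 := (hA.radialQ hB hD).deriv.continuousAt
  unfold radialScal
  exact (ContinuousAt.div (by fun_prop) c1 hA0).add
    (ContinuousAt.div (by fun_prop) (by fun_prop) hD)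

/-- With `ξ = 1 - s φ_a`, `η = 1 - s φ_{1 - a}` and `s = 4 σ`, the functions
`N = 1 - s cothMean a s` and `2 - (ξ + η)` form a closed system of first-order differential
equations, which expresses all derivatives in the curvature through their values. -/
theorem hasDerivAt_wydDenom_and_add {a : ℝ} (ha : a ∈ Set.Ioo (0 : ℝ) 1) {σ : ℝ}
    (hσ : σ ∈ Set.Ioo (0 : ℝ) (1 / 4)) :
    HasDerivAt (fun σ => 1 - 4 * σ * cothMean a (4 * σ))
      ((1 - 4 * σ * cothMean a (4 * σ))
        * (4 * σ * (cothSeries a (4 * σ) + cothSeries (1 - a) (4 * σ)) - 4 * σ)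
        / (2 * σ * (1 - 4 * σ))) σ ∧
    HasDerivAt (fun σ => 4 * σ * (cothSeries a (4 * σ) + cothSeries (1 - a) (4 * σ)))
      (-((2 * a - 1) ^ 2 * (4 * σ)
        + (1 - 4 * σ) * (2 - 4 * σ * (cothSeries a (4 * σ) + cothSeries (1 - a) (4 * σ)))
        - (2 - 4 * σ * (cothSeries a (4 * σ) + cothSeries (1 - a) (4 * σ))) ^ 2
        + 2 * (1 - 4 * σ * cothMean a (4 * σ))) / (2 * σ * (1 - 4 * σ))) σ := by
  have hs : 4 * σ ∈ Set.Ioo (0 : ℝ) 1 := ⟨by linarith [hσ.1], by linarith [hσ.2]⟩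
  have hs' : |4 * σ| < 1 := by rw [abs_of_pos hs.1]; exact hs.2
  have hb0 : 0 ≤ 1 - a := by linarith [ha.2]
  have hb1 : 1 - a ≤ 1 := by linarith [ha.1]
  have d : ∀ b : ℝ, 0 ≤ b → b ≤ 1 → HasDerivAt (fun σ => cothSeries b (4 * σ))
      (deriv (cothSeries b) (4 * σ) * 4) σ := fun b h0 h1 =>
    HasDerivAt.comp (h₂ := cothSeries b) (h := fun σ => 4 * σ) σ (hasDerivAt_cothSeries h0 h1 hs')
      (by simpa using (hasDerivAt_id σ).const_mul 4)
  have d1 := d a ha.1.le ha.2.le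
  have d2 := d (1 - a) hb0 hb1
  have d4 : HasDerivAt (fun σ : ℝ => 4 * σ) 4 σ := by simpa using (hasDerivAt_id σ).const_mul 4
  have o1 := cothSeries_riccati ha.1.le ha.2.le hs'
  have o2 := cothSeries_riccati hb0 hb1 hs'
  have rel := coth_addition ha hs
  have hσ0 : σ ≠ 0 := hσ.1.ne'
  have hu : 1 - 4 * σ ≠ 0 := by linarith [hσ.2]
  constructor
  · refine ((d4.fun_mul ((d1.const_mul (1 - a)).fun_add
      (d2.const_mul a))).const_sub 1).congr_deriv ?_
    rw [eq_div_iff (by positivity)]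
    unfold cothMean at rel ⊢
    generalize cothSeries a (4 * σ) = f at *
    generalize cothSeries (1 - a) (4 * σ) = g at *
    generalize deriv (cothSeries a) (4 * σ) = f' at *
    generalize deriv (cothSeries (1 - a)) (4 * σ) = g' at *
    linear_combination (-4 * σ * (1 - a)) * o1 - 4 * σ * a * o2 + rel
  · refine (d4.fun_mul (d1.fun_add d2)).congr_deriv ?_
    rw [eq_div_iff (by positivity)]
    unfold cothMean at rel ⊢
    generalize cothSeries a (4 * σ) = f at *
    generalize cothSeries (1 - a) (4 * σ) = g at *
    generalize deriv (cothSeries a) (4 * σ) = f' at *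
    generalize deriv (cothSeries (1 - a)) (4 * σ) = g' at *
    linear_combination (4 * σ) * o1 + 4 * σ * o2 - 2 * rel

theorem radialScal_wyd_of_pos {a : ℝ} (ha : a ∈ Set.Ioo (0 : ℝ) 1) {σ : ℝ}
    (hσ : σ ∈ Set.Ioo (0 : ℝ) (1 / 4)) :
    radialScal (wydTangential a) (wydRadialPart a) σ = wydProfile a (4 * σ) := by
  have hsub : ∀ τ ∈ Set.Ioo (0 : ℝ) (1 / 4), τ ∈ Set.Ioo (-1 / 4 : ℝ) (1 / 4) :=
    fun τ hτ => ⟨by linarith [hτ.1], hτ.2⟩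
  set N : ℝ → ℝ := fun σ => 1 - 4 * σ * cothMean a (4 * σ) with hN
  set z : ℝ → ℝ := fun σ => 4 * σ * (cothSeries a (4 * σ) + cothSeries (1 - a) (4 * σ)) with hz
  have dN : ∀ τ ∈ Set.Ioo (0 : ℝ) (1 / 4),
      HasDerivAt N (N τ * (z τ - 4 * τ) / (2 * τ * (1 - 4 * τ))) τ :=
    fun τ hτ => (hasDerivAt_wydDenom_and_add ha hτ).1
  have dz : HasDerivAt z (-((2 * a - 1) ^ 2 * (4 * σ) + (1 - 4 * σ) * (2 - z σ) - (2 - z σ) ^ 2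
      + 2 * N σ) / (2 * σ * (1 - 4 * σ))) σ := (hasDerivAt_wydDenom_and_add ha hσ).2
  have hN0 : ∀ τ ∈ Set.Ioo (0 : ℝ) (1 / 4), N τ ≠ 0 := fun τ hτ => (wydDenom_pos ha (hsub τ hτ)).ne'
  have hA : ∀ τ, wydTangential a τ = 4 / N τ := fun τ => rfl
  have hB : ∀ τ ∈ Set.Ioo (0 : ℝ) (1 / 4),
      wydRadialPart a τ = 4 * (N τ - (1 - 4 * τ)) / (τ * (1 - 4 * τ) * N τ) := by
    intro τ hτ
    have h0 := hN0 τ hτ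
    have h1 : τ ≠ 0 := hτ.1.ne'
    have h2 : 1 - 4 * τ ≠ 0 := by linarith [hτ.2]
    have e : cothMean a (4 * τ) = (1 - N τ) / (4 * τ) := by
      rw [hN]; field_simp; ring
    rw [wydRadialPart, e, show 1 - 4 * τ * ((1 - N τ) / (4 * τ)) = N τ by field_simp; ring]
    field_simp
    ring
  have hA' : ∀ τ ∈ Set.Ioo (0 : ℝ) (1 / 4), deriv (wydTangential a) τ
      = -4 * (z τ - 4 * τ) / (2 * τ * (1 - 4 * τ) * N τ) := by
    intro τ hτ
    have h0 := hN0 τ hτ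
    have h := ((hasDerivAt_const τ (4 : ℝ)).fun_div (dN τ hτ) h0).deriv
    change deriv (fun τ => 4 / N τ) τ = _
    rw [h]
    have h1 : τ ≠ 0 := hτ.1.ne'
    have h2 : 1 - 4 * τ ≠ 0 := by linarith [hτ.2]
    field_simp
    ring
  have hPf : ∀ τ ∈ Set.Ioo (0 : ℝ) (1 / 4), radialP (wydTangential a) (deriv (wydTangential a)) τ
      = -(z τ - 4 * τ) / (2 * τ * (1 - 4 * τ)) := by
    intro τ hτ
    have h0 := hN0 τ hτ
    have h1 : τ ≠ 0 := hτ.1.ne'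
    have h2 : 1 - 4 * τ ≠ 0 := by linarith [hτ.2]
    rw [radialP, hA' τ hτ, hA]
    field_simp
  have hDf : ∀ τ ∈ Set.Ioo (0 : ℝ) (1 / 4),
      wydTangential a τ + τ * wydRadialPart a τ = 4 / (1 - 4 * τ) := by
    intro τ hτ
    rw [wydTangential_add ha (hsub τ hτ), show (1 / 4 - τ) = (1 - 4 * τ) / 4 by ring, one_div_div]
  have hQf : ∀ τ ∈ Set.Ioo (0 : ℝ) (1 / 4),
      radialQ (wydTangential a) (deriv (wydTangential a)) (wydRadialPart a) τ
      = (2 * N τ + 4 * τ - 2 + z τ) / (2 * τ * N τ) := by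
    intro τ hτ
    have h0 := hN0 τ hτ
    have h1 : τ ≠ 0 := hτ.1.ne'
    have h2 : 1 - 4 * τ ≠ 0 := by linarith [hτ.2]
    rw [radialQ, hA' τ hτ, hDf τ hτ, hB τ hτ]
    field_simp
    ring
  have h0 := hN0 σ hσ
  have h1 : σ ≠ 0 := hσ.1.ne'
  have h2 : 1 - 4 * σ ≠ 0 := by linarith [hσ.2]
  have hmem : Set.Ioo (0 : ℝ) (1 / 4) ∈ 𝓝 σ := isOpen_Ioo.mem_nhds hσ
  have hid := hasDerivAt_id' σ
  have hden : HasDerivAt (fun τ : ℝ => 2 * τ * (1 - 4 * τ)) (2 - 16 * σ) σ :=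
    ((hid.const_mul 2).fun_mul ((hid.const_mul 4).const_sub 1)).congr_deriv (by ring)
  have hP' := (Filter.EventuallyEq.deriv_eq (Filter.eventually_of_mem hmem hPf)).trans
    ((dz.fun_sub (hid.const_mul 4)).fun_neg.fun_div hden (by positivity)).deriv
  have hQ' := (Filter.EventuallyEq.deriv_eq (Filter.eventually_of_mem hmem hQf)).trans
    (((((((dN σ hσ).const_mul 2).fun_add (hid.const_mul 4)).sub_const 2).fun_add dz).fun_div
      ((hid.const_mul 2).fun_mul (dN σ hσ)) (by positivity))).deriv
  -- Differentiating `A + σ B = 4 / (1 - 4 σ)` determines `σ B'`, hence `σ R`.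
  have hB' : σ * deriv (wydRadialPart a) σ
      = 16 / (1 - 4 * σ) ^ 2 - deriv (wydTangential a) σ - wydRadialPart a σ := by
    have e1 := ((analyticAt_wydTangential ha (hsub σ hσ)).differentiableAt.hasDerivAt.fun_add
      (hid.fun_mul (analyticAt_wydRadialPart ha (hsub σ hσ)).differentiableAt.hasDerivAt)).deriv
    have e2 := ((hasDerivAt_const σ (4 : ℝ)).fun_div ((hid.const_mul 4).const_sub 1) h2).deriv
    have e3 := Filter.EventuallyEq.deriv_eq (Filter.eventually_of_mem hmem hDf)
    rw [e1, e2] at e3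
    have e4 : (0 * (1 - 4 * σ) - 4 * -(4 * 1)) / (1 - 4 * σ) ^ 2 = 16 / (1 - 4 * σ) ^ 2 := by
      norm_num
    rw [e4] at e3
    linear_combination e3
  have hR : radialR (wydTangential a) (deriv (wydTangential a)) (wydRadialPart a)
      (deriv (wydRadialPart a)) σ = (4 / (1 - 4 * σ)
        + 2 * ((z σ - 4 * σ) / (2 * σ * (1 - 4 * σ)))
        - (2 * N σ + 4 * σ - 2 + z σ) / (2 * σ * N σ)) / σ := by
    have hB'' : deriv (wydRadialPart a) σ
      = (16 / (1 - 4 * σ) ^ 2 - deriv (wydTangential a) σ - wydRadialPart a σ) / σ := by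
      rw [← hB']; field_simp
    rw [radialR, hDf σ hσ, hB'', hA' σ hσ, hB σ hσ, hA]
    field_simp
    ring
  -- The profile, too, is a rational function of `σ`, `N` and `z`, by the addition theorem.
  have hprof : wydProfile a (4 * σ) = (2 * (1 - (2 * a - 1) ^ 2) * (4 * σ) - 3 / 2 * (4 * σ) ^ 2
      + 4 * σ * (2 - z σ - 2 * N σ) + (2 - z σ) ^ 2 / 2 - 2 * N σ) / (4 * σ * (1 - 4 * σ)) := by
    have rel := coth_addition ha (s := 4 * σ) ⟨by linarith [hσ.1], by linarith [hσ.2]⟩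
    rw [wydProfile, hN, hz]
    simp only
    unfold cothMean at rel ⊢
    rw [eq_div_iff (by positivity)]
    field_simp
    linear_combination -4 * rel
  rw [hprof, radialScal]
  simp only [hPf σ hσ, hQf σ hσ, hP', hQ', hR, hDf σ hσ]
  rw [hA]
  generalize N σ = n at *
  generalize z σ = w at *
  clear_value N z
  generalize hu : 1 - 4 * σ = u at *
  field_simp
  obtain rfl : u = 1 - 4 * σ := hu.symm
  ring

/-! ### Nonnegative power series and concavity -/

/-- On `[0, 1)` the function is the sum of a power series with nonnegative coefficients. -/
def HasNonnegExpansion (φ : ℝ → ℝ) : Prop :=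
  ∃ c : ℕ → ℝ, (∀ n, 0 ≤ c n) ∧ ∀ s ∈ Set.Ico (0 : ℝ) 1, HasSum (fun n => c n * s ^ n) (φ s)

namespace HasNonnegExpansion

variable {φ ψ : ℝ → ℝ}

theorem const {k : ℝ} (hk : 0 ≤ k) : HasNonnegExpansion fun _ => k := by
  refine ⟨fun n => if n = 0 then k else 0, fun n => by positivity, fun s _ => ?_⟩
  simpa using hasSum_single (f := fun n : ℕ => (if n = 0 then k else 0) * s ^ n) 0
    fun n hn => by simp [hn]

theorem id : HasNonnegExpansion fun s => s := by
  refine ⟨fun n => if n = 1 then 1 else 0, fun n => by positivity, fun s _ => ?_⟩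
  simpa using hasSum_single (f := fun n : ℕ => (if n = 1 then (1 : ℝ) else 0) * s ^ n) 1
    fun n hn => by simp [hn]

theorem add (hφ : HasNonnegExpansion φ) (hψ : HasNonnegExpansion ψ) :
    HasNonnegExpansion fun s => φ s + ψ s := by
  obtain ⟨c, hc, hφ⟩ := hφ
  obtain ⟨d, hd, hψ⟩ := hψ
  refine ⟨fun n => c n + d n, fun n => add_nonneg (hc n) (hd n), fun s hs => ?_⟩
  simpa only [add_mul] using (hφ s hs).add (hψ s hs)

theorem _root_.hasSum_cauchyProduct {c d : ℕ → ℝ} {s x y : ℝ}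
    (hc : HasSum (fun n => c n * s ^ n) x) (hd : HasSum (fun n => d n * s ^ n) y) :
    HasSum (fun n => (∑ q ∈ Finset.HasAntidiagonal.antidiagonal n, c q.1 * d q.2) * s ^ n)
      (x * y) := by
  have nc := hc.summable.norm
  have nd := hd.summable.norm
  rw [← hc.tsum_eq, ← hd.tsum_eq, tsum_mul_tsum_eq_tsum_sum_antidiagonal_of_summable_norm nc nd]
  refine (summable_norm_sum_mul_antidiagonal_of_summable_norm nc nd).of_norm.hasSum.congr_fun ?_
  intro n
  rw [Finset.sum_mul]
  refine Finset.sum_congr rfl fun q hq => ?_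
  rw [← Finset.HasAntidiagonal.mem_antidiagonal.1 hq, pow_add]
  ring

theorem mul (hφ : HasNonnegExpansion φ) (hψ : HasNonnegExpansion ψ) :
    HasNonnegExpansion fun s => φ s * ψ s := by
  obtain ⟨c, hc, hφ⟩ := hφ
  obtain ⟨d, hd, hψ⟩ := hψ
  exact ⟨_, fun n => Finset.sum_nonneg fun q _ => mul_nonneg (hc _) (hd _),
    fun s hs => hasSum_cauchyProduct (hφ s hs) (hψ s hs)⟩

/-- The coefficients of `(m - φ(s)) / (1 - s)` are the tails of the series `∑ c n = m`. -/
theorem divided_difference {c : ℕ → ℝ} {m : ℝ} (hc : ∀ n, 0 ≤ c n) (hm : HasSum c m)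
    (hφ : ∀ s ∈ Set.Ico (0 : ℝ) 1, HasSum (fun n => c n * s ^ n) (φ s)) :
    HasNonnegExpansion fun s => (m - φ s) / (1 - s) := by
  refine ⟨fun n => m - ∑ k ∈ Finset.range (n + 1), c k, fun n => ?_, fun s hs => ?_⟩
  · exact sub_nonneg.2 (sum_le_hasSum _ (fun k _ => hc k) hm)
  · have hg : HasSum (fun n => (1 : ℝ) * s ^ n) (1 - s)⁻¹ := by
      simpa using hasSum_geometric_of_lt_one hs.1 hs.2
    have h := (hg.mul_left m).sub (hasSum_cauchyProduct (hφ s hs) hg)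
    beta_reduce
    rw [sub_div, div_eq_mul_inv, div_eq_mul_inv]
    refine h.congr_fun fun n => ?_
    rw [Finset.Nat.sum_antidiagonal_eq_sum_range_succ_mk]
    simp
    ring

theorem convexOn_comp_sq (hφ : HasNonnegExpansion φ) :
    ConvexOn ℝ (Set.Ioo (-1 : ℝ) 1) fun r => φ (r ^ 2) := by
  obtain ⟨c, hc, h⟩ := hφ
  have hs : ∀ r ∈ Set.Ioo (-1 : ℝ) 1, HasSum (fun n => c n * (r ^ 2) ^ n) (φ (r ^ 2)) :=
    fun r hr => h _ ⟨sq_nonneg r, (sq_lt_one_iff_abs_lt_one r).2 (abs_lt.2 hr)⟩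
  refine ⟨convex_Ioo _ _, fun x hx y hy a b ha hb hab => ?_⟩
  refine hasSum_le (fun n => ?_) (hs _ (convex_Ioo (-1 : ℝ) 1 hx hy ha hb hab))
    (((hs x hx).mul_left a).add ((hs y hy).mul_left b))
  have := (even_two_mul n).convexOn_pow (𝕜 := ℝ) |>.2 (Set.mem_univ x) (Set.mem_univ y) ha hb hab
  simp only [← pow_mul]
  simp only [smul_eq_mul] at this ⊢
  nlinarith [mul_le_mul_of_nonneg_left this (hc n)]

theorem apply_zero_le (hφ : HasNonnegExpansion φ) {s : ℝ} (hs : s ∈ Set.Ico (0 : ℝ) 1) :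
    φ 0 ≤ φ s := by
  obtain ⟨c, hc, h⟩ := hφ
  refine hasSum_le (fun n => ?_) (h 0 ⟨le_rfl, one_pos⟩) (h s hs)
  gcongr
  · exact hc n
  · exact hs.1

end HasNonnegExpansion

/-- With `g = φ_{1 - a} - φ_a`, `m = 2 a - 1` and `Δ = (m - g) / (1 - s)`, the difference is
`3 / 2 m ^ 2 + 3 / 2 m s Δ + s g Δ / 2`. The coefficients of `g` are nonnegative because those of
`φ_b` decrease in `b`, and they sum to `m`; hence `Δ` has nonnegative coefficients as well. -/
theorem hasNonnegExpansion_wydProfile {a : ℝ} (ha : a ∈ Set.Ioo (1 / 2 : ℝ) 1) :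
    HasNonnegExpansion fun s => 3 / 2 - wydProfile a s := by
  have ha0 : 0 < a := by linarith [ha.1]
  have hb0 : 0 < 1 - a := by linarith [ha.2]
  have hb1 : 1 - a ≤ 1 := by linarith
  set c : ℕ → ℝ := fun n => cothCoeff (1 - a) n - cothCoeff a n with hc
  have hc0 : ∀ n, 0 ≤ c n := fun n =>
    sub_nonneg.2 (cothCoeff_antitone hb0.le (by linarith [ha.1]) ha.2.le n)
  have hm : HasSum c (2 * a - 1) := by
    convert! (hasSum_cothCoeff hb0 hb1).sub (hasSum_cothCoeff ha0 ha.2.le) using 1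
    ring
  have hg : ∀ s ∈ Set.Ico (0 : ℝ) 1,
      HasSum (fun n => c n * s ^ n) (cothSeries (1 - a) s - cothSeries a s) := by
    intro s hs
    have hs' : |s| ≤ 1 := by rw [abs_of_nonneg hs.1]; exact hs.2.le
    simpa only [hc, sub_mul] using!
      (summable_cothCoeff_mul_pow hb0.le hb1 hs').of_norm.hasSum.sub
        (summable_cothCoeff_mul_pow ha0.le ha.2.le hs').of_norm.hasSum
  have hm0 : 0 ≤ 2 * a - 1 := by linarith [ha.1]
  have hG : HasNonnegExpansion fun s => cothSeries (1 - a) s - cothSeries a s := ⟨c, hc0, hg⟩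
  have hΔ := HasNonnegExpansion.divided_difference hc0 hm hg
  obtain ⟨d, hd0, hd⟩ := ((HasNonnegExpansion.const (k := 3 / 2 * (2 * a - 1) ^ 2)
    (by positivity)).add
    ((HasNonnegExpansion.const (k := 3 / 2 * (2 * a - 1)) (by positivity)).mul
      (HasNonnegExpansion.id.mul hΔ))).add
    ((HasNonnegExpansion.const (k := 1 / 2) (by positivity)).mul
      (HasNonnegExpansion.id.mul (hG.mul hΔ)))
  refine ⟨d, hd0, fun s hs => ?_⟩
  convert hd s hs using 1
  have : 1 - s ≠ 0 := by linarith [hs.2]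
  simp only [wydProfile]
  field_simp
  ring

/-- At `σ = 0`, where the formulas for `σ > 0` degenerate, both sides are continuous. -/
theorem radialScal_wyd {a : ℝ} (ha : a ∈ Set.Ioo (0 : ℝ) 1) {σ : ℝ}
    (hσ : σ ∈ Set.Ico (0 : ℝ) (1 / 4)) :
    radialScal (wydTangential a) (wydRadialPart a) σ = wydProfile a (4 * σ) := by
  rcases hσ.1.eq_or_lt with rfl | h0
  · have hmem : (0 : ℝ) ∈ Set.Ioo (-1 / 4 : ℝ) (1 / 4) := by norm_num
    have hD : wydTangential a 0 + 0 * wydRadialPart a 0 ≠ 0 := by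
      rw [wydTangential_add ha hmem]; norm_num
    have hA0 : wydTangential a 0 ≠ 0 := by simpa using hD
    have c1 := ((analyticAt_wydTangential ha hmem).continuousAt_radialScal
      (analyticAt_wydRadialPart ha hmem) hA0 hD)
    have c3 := (analyticAt_cothSeries_four_mul ha.1.le ha.2.le hmem).continuousAt
    have c4 := (analyticAt_cothSeries_four_mul (b := 1 - a) (by linarith [ha.2])
      (by linarith [ha.1]) hmem).continuousAt
    have c2 : ContinuousAt (fun σ => wydProfile a (4 * σ)) 0 := by
      unfold wydProfile
      exact continuousAt_const.sub (ContinuousAt.div (by fun_prop) (by fun_prop) (by norm_num))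
    refine tendsto_nhds_unique (c1.tendsto.mono_left (nhdsWithin_le_nhds (s := Set.Ioi 0)))
      ((c2.tendsto.mono_left nhdsWithin_le_nhds).congr' ?_)
    filter_upwards [Ioo_mem_nhdsGT (show (0 : ℝ) < 1 / 4 by norm_num)] with σ hσ
    exact (radialScal_wyd_of_pos ha hσ).symm
  · exact radialScal_wyd_of_pos ha ⟨h0, hσ.2⟩

theorem monotoneScal_blochMatrix {p : ℝ} (hp : p ∈ Set.Ioo (1 : ℝ) 2) {x : FrameIndex 2 → ℝ}
    (hx : sqNorm x < 1 / 4) :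
    monotoneScal (wydFun p) (blochMatrix x) = wydProfile (1 / p) (4 * sqNorm x) := by
  have ha : 1 / p ∈ Set.Ioo (0 : ℝ) 1 := by
    have : 0 < p := by linarith [hp.1]
    exact ⟨by positivity, by rw [div_lt_one this]; exact hp.1⟩
  have hx0 : 0 ≤ sqNorm x := Finset.sum_nonneg fun i _ => sq_nonneg _
  have hmem : sqNorm x ∈ Set.Ioo (-1 / 4 : ℝ) (1 / 4) := ⟨by linarith, hx⟩
  have hg := isRadialMetric_wyd hp
  have hA := analyticAt_wydTangential ha hmem
  have hB := analyticAt_wydRadialPart ha hmem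
  have hA0 := hg.fst_ne_zero _ hmem
  have hD := hg.radial_ne_zero _ hmem
  rw [← radialScal_wyd ha ⟨hx0, hx⟩]
  exact hg.scalarCurvature_eq pauliEquiv hmem
    (hA.radialP hA0).differentiableAt.hasDerivAt (hA.radialQ hB hD).differentiableAt.hasDerivAt
    (hA.radialR hB hA0 hD).differentiableAt.hasDerivAt rfl rfl rfl rfl

theorem wydScalTwo_eq {p : ℝ} (hp : p ∈ Set.Ioo (1 : ℝ) 2) {a : ℝ} (ha : a ^ 2 < 1) :
    wydScalTwo p a = wydProfile (1 / p) (a ^ 2) := by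
  have hs : sqNorm (fun q => ![0, 0, a / 2] (pauliEquiv.symm q)) = a ^ 2 / 4 := by
    rw [sqNorm_pauli]
    simp
    ring
  rw [wydScalTwo, diagonal_eq_blochMatrix, monotoneScal_blochMatrix hp (by rw [hs]; linarith), hs]
  congr 1
  ring

end

theorem mainTheorem4 (hconj : WYDConjecture) :
    ∃ ε : ℝ, 0 < ε ∧ ∀ p ∈ Set.Ioo (1 : ℝ) (1 + ε),
      (∀ ρ ∈ densityMatrices 2, ∀ i : Fin 2,
        monotoneScal (wydFun p) ρ = wydScalTwo p (2 * hermEigenvalues ρ i - 1)) ∧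
      ConcaveOn ℝ (Set.Ioo (-1 : ℝ) 1) (wydScalTwo p) ∧
      IsMaxOn (wydScalTwo p) (Set.Ioo (-1 : ℝ) 1) 0 := by
  -- For `p < 2` the exponent `1 / p` exceeds its conjugate `1 - 1 / p`.
  refine ⟨1, one_pos, fun p hp => ?_⟩
  rw [one_add_one_eq_two] at hp
  have hp0 : 0 < p := by linarith [hp.1]
  have ha : 1 / p ∈ Set.Ioo (1 / 2 : ℝ) 1 :=
    ⟨one_div_lt_one_div_of_lt hp0 hp.2, by rw [div_lt_one hp0]; exact hp.1⟩
  have hexp := hasNonnegExpansion_wydProfile ha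
  have hsq : ∀ r ∈ Set.Ioo (-1 : ℝ) 1, r ^ 2 < 1 := fun r hr =>
    (sq_lt_one_iff_abs_lt_one r).2 (abs_lt.2 hr)
  refine ⟨fun ρ hρ i => ?_, ?_, fun r hr => ?_⟩
  · obtain ⟨x, hx, rfl⟩ := exists_blochMatrix hρ
    have hi := sq_hermEigenvalues_blochMatrix x i
    rw [monotoneScal_blochMatrix hp hx, wydScalTwo_eq hp (by rw [hi]; linarith), hi]
  · refine ((concaveOn_const (3 / 2) (convex_Ioo _ _)).sub hexp.convexOn_comp_sq).congr
      fun r hr => ?_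
    simp [wydScalTwo_eq hp (hsq r hr)]
  · have := hexp.apply_zero_le (s := r ^ 2) ⟨sq_nonneg r, hsq r hr⟩
    simp only [Set.mem_ofPred_eq, wydScalTwo_eq hp (hsq r hr),
      wydScalTwo_eq hp (a := 0) (by norm_num)]
    rw [zero_pow two_ne_zero]
    linarith
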